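/- A *geometric graph* is a finite graph whose vertices are distinct points of $\mathbb{R}^2$ and whose edges are drawn as straight segments; here it is plane, that is, an edge contains no vertex other than its endpoints and two distinct edges meet at most in common endpoints. Its *faces* are the connected components of the complement of the drawing. A *triangulation* is a plane geometric graph all of whose faces, except the outer (unbounded) face, are triangles, and whose outer face is the complement of a triangle (the sides of all these triangles being edges of the graph). For a target vertex $t$ and a vertex $v\neq t$, measure the angle of a neighbour $u$ of $v$ counterclockwise from the segment $vt$ to the segment $vu$, with values in $[0,2\pi)$, and let $\mathrm{ccw}_t(v)$ and $\mathrm{cw}_t(v)$ be the neighbours of $v$ of minimum and maximum angle, respectively. The Random-Compass algorithm, when routing to $t$, moves in each step from the current vertex $v\ne t$ to $\mathrm{ccw}_t(v)$ or to $\mathrm{cw}_t(v)$, each with probability $1/2$, using a fresh fair random bit for each step, and stops when it reaches $t$. **Theorem.** There is a constant $c>0$ such that for every integer $n\ge 3$ there exist a triangulation $G$ with $n$ vertices and two vertices $s,t$ of $G$ such that the expected number $T$ of steps taken by Random-Compass when routing from $s$ to $t$ is finite and satisfies $$T\ \ge\ 2^{cn}\qquad\text{and}\qquad T\ \ge\ c\,2^{n/4}.$$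 In particular $T = 2^{\Omega(n)}$, and indeed $T=\Omega(2^{n/4})$. -/

import Mathlib

open MeasureTheory
open scoped ENNReal

/-- A geometric graph: a graph whose vertices are distinct points of the Euclidean plane,
the plane being `ℂ`. The edge between adjacent `u` and `v` is drawn as a straight segment. -/
structure GeometricGraph (V : Type) where
  /-- The underlying abstract graph. -/
  graph : SimpleGraph V
  /-- The position of each vertex. -/
  pos : V → ℂ
  pos_injective : Function.Injective pos

namespace GeometricGraph

variable {V : Type}

/-- The straight-line segment joining (the positions of) two vertices. -/
def seg (G : GeometricGraph V) (u v : V) : Set ℂ :=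
  segment ℝ (G.pos u) (G.pos v)

/-- The set of points of the plane covered by the vertices and the edges. -/
def drawing (G : GeometricGraph V) : Set ℂ :=
  Set.range G.pos ∪ {z | ∃ u v, G.graph.Adj u v ∧ z ∈ G.seg u v}

/-- The straight-line drawing is a plane embedding: an edge contains no vertex other than its two
endpoints, and two different edges meet at most in common endpoints. -/
def IsPlane (G : GeometricGraph V) : Prop :=
  (∀ u v w, G.graph.Adj u v → G.pos w ∈ G.seg u v → w = u ∨ w = v) ∧
  (∀ u v x y, G.graph.Adj u v → G.graph.Adj x y → s(u, v) ≠ s(x, y) →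
    G.seg u v ∩ G.seg x y ⊆ G.pos '' (({u, v} : Set V) ∩ {x, y}))

/-- The faces: the connected components of the complement of the drawing. -/
def IsFace (G : GeometricGraph V) (F : Set ℂ) : Prop :=
  ∃ z ∈ (G.drawing)ᶜ, F = connectedComponentIn (G.drawing)ᶜ z

/-- The closed triangle spanned by three vertices. -/
def triangle (G : GeometricGraph V) (a b c : V) : Set ℂ :=
  convexHull ℝ {G.pos a, G.pos b, G.pos c}

/-- Three pairwise adjacent vertices. (In a plane geometric graph they are never collinear.) -/
def Is3Cycle (G : GeometricGraph V) (a b c : V) : Prop :=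
  G.graph.Adj a b ∧ G.graph.Adj b c ∧ G.graph.Adj a c

/-- A triangulation: a plane geometric graph all of whose faces, except the outer (that is,
unbounded) face, are triangles, and whose outer face is the complement of a triangle. The sides of
each of these triangles are edges of the graph. -/
def IsTriangulation (G : GeometricGraph V) : Prop :=
  G.IsPlane ∧
  (∀ F, G.IsFace F → Bornology.IsBounded F →
    ∃ a b c, G.Is3Cycle a b c ∧ F = interior (G.triangle a b c)) ∧
  (∀ F, G.IsFace F → ¬ Bornology.IsBounded F →
    ∃ a b c, G.Is3Cycle a b c ∧ F = (G.triangle a b c)ᶜ)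

/-- The angle, in `[0, 2π)`, by which the ray from `v` through `t` has to be turned
counterclockwise about `v` to pass through `u`. -/
noncomputable def ccwAngle (G : GeometricGraph V) (t v u : V) : ℝ :=
  toIcoMod Real.two_pi_pos 0 (Complex.arg ((G.pos u - G.pos v) / (G.pos t - G.pos v)))

open Classical in
/-- The neighbour of `v` that makes the minimum counterclockwise angle with the segment `vt`.
(It is unique in a plane geometric graph; the value is `v` if `v` has no neighbour.) -/
noncomputable def ccw (G : GeometricGraph V) (t v : V) : V :=
  if h : ∃ u, G.graph.Adj v u ∧ ∀ w, G.graph.Adj v w → G.ccwAngle t v u ≤ G.ccwAngle t v w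
  then h.choose else v

open Classical in
/-- The neighbour of `v` that makes the maximum counterclockwise angle with the segment `vt`.
(It is unique in a plane geometric graph; the value is `v` if `v` has no neighbour.) -/
noncomputable def cw (G : GeometricGraph V) (t v : V) : V :=
  if h : ∃ u, G.graph.Adj v u ∧ ∀ w, G.graph.Adj v w → G.ccwAngle t v w ≤ G.ccwAngle t v u
  then h.choose else v

open Classical in
/-- One step of Random-Compass with target `t` from the node `v`, using one random bit.
The packet stays at `t` once it is there. -/
noncomputable def randomCompassStep (G : GeometricGraph V) (t v : V) (b : Bool) : V :=
  if v = t then t else if b then G.ccw t v else G.cw t v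

/-- The position of the packet after `m` steps of Random-Compass from `s` to `t`, where the `i`-th
step uses the bit `ω i`. -/
noncomputable def route (G : GeometricGraph V) (s t : V) (ω : ℕ → Bool) : ℕ → V
  | 0 => s
  | m + 1 => G.randomCompassStep t (G.route s t ω m) (ω m)

/-- The number of steps until the packet reaches `t` (it is `∞` if it never does). -/
noncomputable def numSteps (G : GeometricGraph V) (s t : V) (ω : ℕ → Bool) : ℝ≥0∞ :=
  ⨅ (m : ℕ) (_ : G.route s t ω m = t), (m : ℝ≥0∞)

end GeometricGraph

/-- The law of an infinite sequence of independent fair random bits. -/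
noncomputable def fairBits : Measure (ℕ → Bool) :=
  Measure.infinitePi fun _ => (PMF.uniformOfFintype Bool).toMeasure

/-- The expected number of steps taken by Random-Compass when routing from `s` to `t`. -/
noncomputable def GeometricGraph.expectedSteps {V : Type} (G : GeometricGraph V) (s t : V) :
    ℝ≥0∞ :=
  ∫⁻ ω, G.numSteps s t ω ∂fairBits

/-!
The target is placed at the origin, inside an octahedron drawn with one triangle around another, the
inner triangle being twisted clockwise against the outer one. The twist makes the outer corners
chase each other: from an outer corner the clockwise compass neighbour is the next outer corner,
while the counterclockwise one is an inner corner, from which the target can be reached directly.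
Into the triangle spanned by an outer corner, its clockwise neighbour `a` and its counterclockwise
neighbour `u` a chain of vertices is inserted, each joined to the previous one, to `a` and to `u`.
From a chain vertex one moves clockwise to `a`, thus back to the beginning of another chain, and
counterclockwise to the next vertex of the chain, at last to `u`. So each passage to the inner
triangle takes a run of counterclockwise steps as long as a chain, which is about `n / 3`, and the
expected waiting time for a run of `K` heads of a fair coin is at least `1 + 2 ^ K / 4`
(`GeometricGraph.le_expectedSteps`). It is finite because a run of at most `n + 2` counterclockwise
steps leads to the target from everywhere (`GeometricGraph.expectedSteps_lt_top`). For `n < 7` a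
triangulation in which all vertices are adjacent to the target suffices.

That these drawings are triangulations is proved by counting. A `Tiling` is a simplicial complex
whose open cells (vertices, open edges, open triangles), together with the complement of the outer
triangle, cover each point of the plane exactly once. This yields planarity and determines the faces
(`Tiling.isTriangulation`). It is preserved when a vertex is inserted into a triangle
(`Tiling.insert_vertex`), and the covering property also survives an exchange of the diagonals of a
strictly convex quadrilateral (`Partitions.flipDiagonal`). The octahedron arises from a triangle by
three insertions and one exchange; insertions alone would not do, since they only produce nested
triangles around the target, which the walk never leaves once it has entered them.

The compass neighbours are read off from the tiling too (`Tiling.compass_eq`): if the ray from `v` to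
the target enters the triangle `v u w`, they are `u` and `w`, as no edge at `v` enters an open
triangle.
-/

/-! ### Signed areas and barycentric coordinates in the plane -/

/-- Twice the signed area of the triangle with vertices `0`, `z`, `w`. -/
def cross (z w : ℂ) : ℝ := z.re * w.im - z.im * w.re

/-- Twice the signed area of the triangle `a b c`. -/
def orient (a b c : ℂ) : ℝ := cross (b - a) (c - a)

theorem exists_barycentric {a b c : ℂ} (h : orient a b c ≠ 0) (z : ℂ) :
    ∃ x y w : ℝ, x + y + w = 1 ∧ x • a + y • b + w • c = z := by
  refine ⟨1 - orient a z c / orient a b c - orient a b z / orient a b c,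
    orient a z c / orient a b c, orient a b z / orient a b c, by ring, ?_⟩
  apply Complex.ext <;> simp <;> field_simp <;> simp [orient, cross] <;> ring

theorem barycentric_unique {a b c : ℂ} (h : orient a b c ≠ 0) {x y w x' y' w' : ℝ}
    (h1 : x + y + w = 1) (h1' : x' + y' + w' = 1)
    (he : x • a + y • b + w • c = x' • a + y' • b + w' • c) : x = x' ∧ y = y' ∧ w = w' := by
  have hr := congrArg Complex.re he
  have hi := congrArg Complex.im he
  simp at hr hi
  have hy : (y - y') * orient a b c = 0 := by
    obtain rfl : x = 1 - y - w := by linarith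
    obtain rfl : x' = 1 - y' - w' := by linarith
    simp only [orient, cross, Complex.sub_re, Complex.sub_im]
    linear_combination (c.im - a.im) * hr - (c.re - a.re) * hi
  have hw : (w - w') * orient a b c = 0 := by
    obtain rfl : x = 1 - y - w := by linarith
    obtain rfl : x' = 1 - y' - w' := by linarith
    simp only [orient, cross, Complex.sub_re, Complex.sub_im]
    linear_combination -(b.im - a.im) * hr + (b.re - a.re) * hi
  have hy' : y - y' = 0 := (mul_eq_zero.1 hy).resolve_right h
  have hw' : w - w' = 0 := (mul_eq_zero.1 hw).resolve_right h
  exact ⟨by linarith, by linarith, by linarith⟩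

/-- The open triangle spanned by three points. -/
def openTriangle (a b c : ℂ) : Set ℂ :=
  {z | ∃ x y w : ℝ, 0 < x ∧ 0 < y ∧ 0 < w ∧ x + y + w = 1 ∧ x • a + y • b + w • c = z}

theorem openTriangle_rotate (a b c : ℂ) : openTriangle a b c = openTriangle b c a := by
  ext z
  constructor
  · rintro ⟨x, y, w, hx, hy, hw, h1, rfl⟩
    exact ⟨y, w, x, hy, hw, hx, by linarith, by abel⟩
  · rintro ⟨x, y, w, hx, hy, hw, h1, rfl⟩
    exact ⟨w, x, y, hw, hx, hy, by linarith, by abel⟩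

theorem openTriangle_swap (a b c : ℂ) : openTriangle a b c = openTriangle b a c := by
  ext z
  constructor
  · rintro ⟨x, y, w, hx, hy, hw, h1, rfl⟩
    exact ⟨y, x, w, hy, hx, hw, by linarith, by abel⟩
  · rintro ⟨x, y, w, hx, hy, hw, h1, rfl⟩
    exact ⟨y, x, w, hy, hx, hw, by linarith, by abel⟩

/-! ### Counting identities for open cells -/

open Classical in
/-- The indicator of a set of points of the plane, with natural number values. -/
noncomputable def ind (S : Set ℂ) (z : ℂ) : ℕ := if z ∈ S then 1 else 0

theorem ind_eq_add_three {S A B C : Set ℂ} {z : ℂ} (h : z ∈ S ↔ z ∈ A ∨ z ∈ B ∨ z ∈ C)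
    (hAB : z ∈ A → z ∉ B) (hAC : z ∈ A → z ∉ C) (hBC : z ∈ B → z ∉ C) :
    ind S z = ind A z + ind B z + ind C z := by
  unfold ind
  by_cases hA : z ∈ A <;> by_cases hB : z ∈ B <;> by_cases hC : z ∈ C <;> simp_all

theorem mem_openSegment_iff_smul {a b z : ℂ} :
    z ∈ openSegment ℝ a b ↔ ∃ t : ℝ, (0 < t ∧ t < 1) ∧ a + t • (b - a) = z := by
  rw [openSegment_eq_image']
  rfl

/-- An open segment is split by any of its points. -/
theorem ind_openSegment_split {a b m : ℂ} (hab : a ≠ b) (hm : m ∈ openSegment ℝ a b) (z : ℂ) :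
    ind (openSegment ℝ a b) z
      = ind (openSegment ℝ a m) z + ind {m} z + ind (openSegment ℝ m b) z := by
  obtain ⟨s, ⟨hs0, hs1⟩, rfl⟩ := mem_openSegment_iff_smul.1 hm
  have hba : b - a ≠ 0 := sub_ne_zero.2 hab.symm
  have hinj : ∀ t t' : ℝ, a + t • (b - a) = a + t' • (b - a) → t = t' := fun t t' h =>
    smul_left_injective ℝ hba (add_left_cancel h)
  have hA : ∀ t : ℝ, a + t • (b - a) ∈ openSegment ℝ a (a + s • (b - a)) ↔ 0 < t ∧ t < s := by
    intro t
    rw [mem_openSegment_iff_smul]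
    constructor
    · rintro ⟨r, ⟨hr0, hr1⟩, h⟩
      have : r * s = t := hinj _ _ (by rw [← h]; module)
      subst this
      exact ⟨by positivity, by nlinarith⟩
    · rintro ⟨h0, h1⟩
      refine ⟨t / s, ⟨by positivity, by rwa [div_lt_one hs0]⟩, ?_⟩
      rw [add_sub_cancel_left, smul_smul, div_mul_cancel₀ _ hs0.ne']
  have hB : ∀ t : ℝ, a + t • (b - a) ∈ openSegment ℝ (a + s • (b - a)) b ↔ s < t ∧ t < 1 := by
    intro t
    rw [mem_openSegment_iff_smul]
    constructor
    · rintro ⟨r, ⟨hr0, hr1⟩, h⟩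
      have : s + r * (1 - s) = t := hinj _ _ (by rw [← h]; module)
      subst this
      exact ⟨by nlinarith, by nlinarith⟩
    · rintro ⟨h0, h1⟩
      have h1s : 0 < 1 - s := by linarith
      refine ⟨(t - s) / (1 - s), ⟨div_pos (by linarith) h1s, by rw [div_lt_one h1s]; linarith⟩, ?_⟩
      have : b - (a + s • (b - a)) = (1 - s) • (b - a) := by module
      rw [this, smul_smul, div_mul_cancel₀ _ h1s.ne']
      module
  apply ind_eq_add_three
  · constructor
    · intro hz
      obtain ⟨t, ⟨ht0, ht1⟩, rfl⟩ := mem_openSegment_iff_smul.1 hz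
      rw [hA, hB]
      rcases lt_trichotomy t s with h | h | h
      · exact Or.inl ⟨ht0, h⟩
      · exact Or.inr (Or.inl (by rw [h]; rfl))
      · exact Or.inr (Or.inr ⟨h, ht1⟩)
    · rintro (hz | hz | hz)
      · obtain ⟨r, ⟨hr0, hr1⟩, rfl⟩ := mem_openSegment_iff_smul.1 hz
        exact mem_openSegment_iff_smul.2 ⟨r * s, ⟨by positivity, by nlinarith⟩, by module⟩
      · rw [Set.mem_singleton_iff] at hz
        rwa [hz]
      · obtain ⟨r, ⟨hr0, hr1⟩, rfl⟩ := mem_openSegment_iff_smul.1 hz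
        exact mem_openSegment_iff_smul.2
          ⟨s + r * (1 - s), ⟨by nlinarith, by nlinarith⟩, by module⟩
  · intro h h'
    rw [Set.mem_singleton_iff] at h'
    rw [h', hA] at h
    exact lt_irrefl _ h.2
  · intro h h'
    obtain ⟨r, ⟨hr0, hr1⟩, rfl⟩ := mem_openSegment_iff_smul.1 h
    have : a + r • (a + s • (b - a) - a) = a + (r * s) • (b - a) := by module
    rw [this, hB] at h'
    nlinarith [h'.1]
  · intro h h'
    rw [Set.mem_singleton_iff] at h
    rw [h, hB] at h'
    exact lt_irrefl _ h'.1

/-- A triangle `a b c` is split by the segment joining `c` to a point `m` between `a` and `b`. -/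
theorem ind_openTriangle_split {a b c m : ℂ} (h : orient a b c ≠ 0)
    (hm : m ∈ openSegment ℝ a b) (z : ℂ) :
    ind (openTriangle a b c) z
      = ind (openTriangle a m c) z + ind (openSegment ℝ m c) z + ind (openTriangle m b c) z := by
  obtain ⟨s, ⟨hs0, hs1⟩, rfl⟩ := mem_openSegment_iff_smul.1 hm
  have h1s : 0 < 1 - s := by linarith
  obtain ⟨x, y, w, h1, rfl⟩ := exists_barycentric h z
  have hS : x • a + y • b + w • c ∈ openTriangle a b c ↔ 0 < x ∧ 0 < y ∧ 0 < w := by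
    constructor
    · rintro ⟨x', y', w', hx, hy, hw, h1', he⟩
      obtain ⟨rfl, rfl, rfl⟩ := barycentric_unique h h1' h1 he
      exact ⟨hx, hy, hw⟩
    · rintro ⟨hx, hy, hw⟩
      exact ⟨x, y, w, hx, hy, hw, h1, rfl⟩
  have hA : x • a + y • b + w • c ∈ openTriangle a (a + s • (b - a)) c ↔
      0 < y ∧ 0 < w ∧ y * (1 - s) < x * s := by
    constructor
    · rintro ⟨x', y', w', hx, hy, hw, h1', he⟩
      obtain ⟨rfl, rfl, rfl⟩ := barycentric_unique h
        (x := x' + y' * (1 - s)) (y := y' * s) (w := w') (by linarith) h1 (by rw [← he]; module)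
      exact ⟨by positivity, hw, by nlinarith [mul_pos hx hs0]⟩
    · rintro ⟨hy, hw, hlt⟩
      refine ⟨x - y / s * (1 - s), y / s, w, ?_, by positivity, hw, ?_, ?_⟩
      · rw [div_mul_eq_mul_div, sub_pos, div_lt_iff₀ hs0]
        exact hlt
      · linear_combination h1 + div_mul_cancel₀ y hs0.ne'
      · have : y / s * s = y := div_mul_cancel₀ _ hs0.ne'
        nth_rewrite 3 [← this]
        module
  have hB : x • a + y • b + w • c ∈ openTriangle (a + s • (b - a)) b c ↔
      0 < x ∧ 0 < w ∧ x * s < y * (1 - s) := by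
    constructor
    · rintro ⟨x', y', w', hx, hy, hw, h1', he⟩
      obtain ⟨rfl, rfl, rfl⟩ := barycentric_unique h
        (x := x' * (1 - s)) (y := y' + x' * s) (w := w') (by linarith) h1 (by rw [← he]; module)
      exact ⟨by positivity, hw, by nlinarith [mul_pos hy h1s]⟩
    · rintro ⟨hx, hw, hlt⟩
      refine ⟨x / (1 - s), y - x / (1 - s) * s, w, by positivity, ?_, hw, ?_, ?_⟩
      · rw [div_mul_eq_mul_div, sub_pos, div_lt_iff₀ h1s]
        exact hlt
      · linear_combination h1 + div_mul_cancel₀ x h1s.ne'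
      · have : x / (1 - s) * (1 - s) = x := div_mul_cancel₀ _ h1s.ne'
        nth_rewrite 3 [← this]
        module
  have hC : x • a + y • b + w • c ∈ openSegment ℝ (a + s • (b - a)) c ↔
      0 < x ∧ 0 < y ∧ 0 < w ∧ x * s = y * (1 - s) := by
    constructor
    · intro hz
      obtain ⟨r, ⟨hr0, hr1⟩, he⟩ := mem_openSegment_iff_smul.1 hz
      have hr : 0 < 1 - r := by linarith
      obtain ⟨rfl, rfl, rfl⟩ := barycentric_unique h
        (x := (1 - r) * (1 - s)) (y := (1 - r) * s) (w := r) (by ring) h1 (by rw [← he]; module)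
      exact ⟨by positivity, by positivity, hr0, by ring⟩
    · rintro ⟨hx, hy, hw, heq⟩
      refine mem_openSegment_iff_smul.2 ⟨w, ⟨hw, by linarith⟩, ?_⟩
      have hy' : y = (1 - w) * s := by rw [← h1]; linear_combination (-1 : ℝ) * heq
      obtain rfl : x = (1 - w) * (1 - s) := by linarith
      rw [hy']
      module
  apply ind_eq_add_three
  · rw [hS, hA, hB, hC]
    constructor
    · rintro ⟨hx, hy, hw⟩
      rcases lt_trichotomy (x * s) (y * (1 - s)) with hlt | heq | hlt
      · exact Or.inr (Or.inr ⟨hx, hw, hlt⟩)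
      · exact Or.inr (Or.inl ⟨hx, hy, hw, heq⟩)
      · exact Or.inl ⟨hy, hw, hlt⟩
    · rintro (⟨hy, hw, hlt⟩ | ⟨hx, hy, hw, heq⟩ | ⟨hx, hw, hlt⟩)
      · exact ⟨pos_of_mul_pos_left (lt_trans (by positivity) hlt) hs0.le, hy, hw⟩
      · exact ⟨hx, hy, hw⟩
      · exact ⟨hx, pos_of_mul_pos_left (lt_trans (by positivity) hlt) h1s.le, hw⟩
  · rw [hA, hC]
    exact fun h h' => h.2.2.ne' h'.2.2.2
  · rw [hA, hB]
    exact fun h h' => lt_asymm h.2.2 h'.2.2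
  · rw [hC, hB]
    exact fun h h' => h'.2.2.ne h.2.2.2

/-- An open triangle is cut into seven cells by joining one of its points `p` to its corners. -/
theorem ind_openTriangle_star {a b c p : ℂ} (h : orient a b c ≠ 0)
    (hp : p ∈ openTriangle a b c) (z : ℂ) :
    ind (openTriangle a b c) z = ind {p} z
      + (ind (openSegment ℝ p a) z + ind (openSegment ℝ p b) z + ind (openSegment ℝ p c) z)
      + (ind (openTriangle p a b) z + ind (openTriangle p a c) z + ind (openTriangle p b c) z) := by
  obtain ⟨x, y, w, hx, hy, hw, h1, rfl⟩ := hp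
  have hyw : 0 < y + w := by positivity
  -- `q` is the point where the line through `a` and `p` meets the side `b c`.
  obtain ⟨q, hq⟩ : ∃ q : ℂ, q = b + (w / (y + w)) • (c - b) := ⟨_, rfl⟩
  have hqm : q ∈ openSegment ℝ b c := mem_openSegment_iff_smul.2
    ⟨w / (y + w), ⟨by positivity, by rw [div_lt_one hyw]; linarith⟩, hq.symm⟩
  have hpq : x • a + y • b + w • c = a + (y + w) • (q - a) := by
    have : (y + w) • q = y • b + w • c := by
      rw [hq, smul_add, smul_smul, mul_div_cancel₀ _ hyw.ne']
      module
    rw [smul_sub, this]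
    obtain rfl : x = 1 - y - w := by linarith
    module
  have hpm : x • a + y • b + w • c ∈ openSegment ℝ a q :=
    mem_openSegment_iff_smul.2 ⟨y + w, ⟨hyw, by linarith⟩, hpq.symm⟩
  have hqo : orient a b q = (w / (y + w)) * orient a b c := by
    rw [hq]
    generalize w / (y + w) = r
    simp [orient, cross]
    ring
  have hqo' : orient a q c = (1 - w / (y + w)) * orient a b c := by
    rw [hq]
    generalize w / (y + w) = r
    simp [orient, cross]
    ring
  have hf : 0 < 1 - w / (y + w) := by
    rw [sub_pos, div_lt_one hyw]; linarith
  have haq : orient a q b ≠ 0 := by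
    have : orient a q b = - orient a b q := by simp [orient, cross]; ring
    rw [this, hqo]
    exact neg_ne_zero.2 (mul_ne_zero (by positivity) h)
  have haq' : orient a q c ≠ 0 := by rw [hqo']; exact mul_ne_zero hf.ne' h
  have hne : a ≠ q := by
    rintro rfl
    simp [orient, cross] at haq
  generalize x • a + y • b + w • c = p at hpm hpq
  have hpo : orient b c p ≠ 0 := by
    have : orient b c p = (1 - (y + w)) * orient a b c := by
      rw [hpq, hq]
      generalize w / (y + w) = r
      simp [orient, cross]
      ring
    rw [this]
    exact mul_ne_zero (by linarith) h
  have e1 := ind_openTriangle_split (a := b) (b := c) (c := a) (m := q)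
    (by rw [show orient b c a = orient a b c by simp [orient, cross]; ring]; exact h) hqm z
  have e2 := ind_openSegment_split hne hpm z
  have e3 := ind_openTriangle_split haq hpm z
  have e4 := ind_openTriangle_split haq' hpm z
  have e5 := ind_openTriangle_split hpo hqm z
  rw [← openTriangle_rotate a b c] at e1
  rw [openTriangle_rotate b q a, openSegment_symm ℝ q a] at e1
  rw [openTriangle_rotate q c a, openTriangle_rotate c a q] at e1
  rw [openTriangle_swap q a b] at e1
  rw [openTriangle_swap a p b] at e3
  rw [openTriangle_swap a p c] at e4
  rw [← openTriangle_rotate p b c, openTriangle_rotate b q p, openTriangle_rotate q c p,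
    openTriangle_rotate c p q, openSegment_symm ℝ q p, openTriangle_swap q p b] at e5
  rw [openSegment_symm ℝ a p] at e2
  omega

/-- Exchanging the diagonals of a strictly convex quadrilateral. -/
theorem ind_flip {a b c d m : ℂ} (h1 : orient a b c ≠ 0) (h2 : orient a b d ≠ 0)
    (h3 : orient c d a ≠ 0) (h4 : orient c d b ≠ 0)
    (hm : m ∈ openSegment ℝ a b) (hm' : m ∈ openSegment ℝ c d) (z : ℂ) :
    ind (openTriangle a b c) z + ind (openTriangle a b d) z + ind (openSegment ℝ a b) z
      = ind (openTriangle c d a) z + ind (openTriangle c d b) z + ind (openSegment ℝ c d) z := by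
  have hab : a ≠ b := by rintro rfl; simp [orient, cross] at h1
  have hcd : c ≠ d := by rintro rfl; simp [orient, cross] at h3
  have e1 := ind_openTriangle_split h1 hm z
  have e2 := ind_openTriangle_split h2 hm z
  have e3 := ind_openTriangle_split h3 hm' z
  have e4 := ind_openTriangle_split h4 hm' z
  have e5 := ind_openSegment_split hab hm z
  have e6 := ind_openSegment_split hcd hm' z
  rw [openTriangle_rotate c m a, openTriangle_swap m a c, openSegment_symm ℝ m a,
    openTriangle_rotate m d a, openTriangle_rotate d a m] at e3
  rw [openTriangle_rotate c m b, openTriangle_swap m d b, openTriangle_rotate d m b] at e4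
  rw [openSegment_symm ℝ m c] at e1
  omega

/-! ### Cells and tilings -/

/-- The open simplex spanned by the points with indices in `σ`: a point, an open segment or an open
triangle when `σ` has one, two or three elements. -/
def cell (P : ℕ → ℂ) (σ : Finset ℕ) : Set ℂ :=
  {z | ∃ w : ℕ → ℝ, (∀ i ∈ σ, 0 < w i) ∧ ∑ i ∈ σ, w i = 1 ∧ ∑ i ∈ σ, w i • P i = z}

theorem cell_singleton (P : ℕ → ℂ) (i : ℕ) : cell P {i} = {P i} := by
  ext z
  simp only [cell, Finset.mem_singleton, forall_eq, Finset.sum_singleton, Set.mem_ofPred_eq,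
    Set.mem_singleton_iff]
  constructor
  · rintro ⟨w, -, h1, rfl⟩
    rw [h1, one_smul]
  · rintro rfl
    exact ⟨fun _ => 1, one_pos, rfl, one_smul _ _⟩

theorem cell_pair (P : ℕ → ℂ) {i j : ℕ} (h : i ≠ j) :
    cell P {i, j} = openSegment ℝ (P i) (P j) := by
  ext z
  constructor
  · rintro ⟨w, hw, h1, rfl⟩
    rw [Finset.sum_pair h] at h1 ⊢
    exact ⟨w i, w j, hw i (by simp), hw j (by simp), h1, rfl⟩
  · rintro ⟨a, b, ha, hb, hab, rfl⟩
    refine ⟨fun k => if k = i then a else b, ?_, ?_, ?_⟩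
    · intro k _
      dsimp only
      split_ifs <;> assumption
    · rw [Finset.sum_pair h, if_pos rfl, if_neg h.symm, hab]
    · rw [Finset.sum_pair h]
      simp [h.symm]

theorem sum_triple {M : Type*} [AddCommMonoid M] (f : ℕ → M) {i j k : ℕ} (hij : i ≠ j)
    (hik : i ≠ k) (hjk : j ≠ k) : ∑ l ∈ {i, j, k}, f l = f i + f j + f k := by
  rw [Finset.sum_insert (by simp [hij, hik]), Finset.sum_pair hjk, add_assoc]

theorem cell_triple (P : ℕ → ℂ) {i j k : ℕ} (hij : i ≠ j) (hik : i ≠ k) (hjk : j ≠ k) :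
    cell P {i, j, k} = openTriangle (P i) (P j) (P k) := by
  ext z
  constructor
  · rintro ⟨w, hw, h1, rfl⟩
    rw [sum_triple _ hij hik hjk] at h1 ⊢
    exact ⟨w i, w j, w k, hw i (by simp), hw j (by simp), hw k (by simp), h1, rfl⟩
  · rintro ⟨a, b, c, ha, hb, hc, h1, rfl⟩
    refine ⟨fun l => if l = i then a else if l = j then b else c, ?_, ?_, ?_⟩
    · intro l _
      dsimp only
      split_ifs <;> assumption
    · rw [sum_triple _ hij hik hjk]
      simp [hij.symm, hik.symm, hjk.symm, h1]
    · rw [sum_triple _ hij hik hjk]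
      simp [hij.symm, hik.symm, hjk.symm]

/-- The open cells of the family `K`, together with the complement of the closed triangle with
corners indexed by `o`, partition the plane: each point is counted exactly once. -/
def Partitions (P : ℕ → ℂ) (K : Finset (Finset ℕ)) (o : Finset ℕ) : Prop :=
  ∀ z, ∑ σ ∈ K, ind (cell P σ) z + ind (convexHull ℝ (P '' o))ᶜ z = 1

/-- A two-dimensional simplicial complex `K` whose open cells partition the closed triangle with
corners indexed by `o`. -/
structure Tiling (P : ℕ → ℂ) (K : Finset (Finset ℕ)) (o : Finset ℕ) : Prop where
  nonempty : ∀ σ ∈ K, σ.Nonempty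
  card_le : ∀ σ ∈ K, σ.card ≤ 3
  down : ∀ σ ∈ K, ∀ τ ⊆ σ, τ.Nonempty → τ ∈ K
  outer_card : o.card = 3
  outer_edges : ∀ τ ⊆ o, τ.card = 2 → τ ∈ K
  partitions : Partitions P K o

/-- Stellar subdivision of the face `f` at the new vertex `v`. -/
def stellar (K : Finset (Finset ℕ)) (f : Finset ℕ) (v : ℕ) : Finset (Finset ℕ) :=
  K.erase f ∪ f.ssubsets.image (insert v)

theorem mem_stellar {K : Finset (Finset ℕ)} {f σ : Finset ℕ} {v : ℕ} :
    σ ∈ stellar K f v ↔ (σ ≠ f ∧ σ ∈ K) ∨ ∃ τ, τ ⊂ f ∧ insert v τ = σ := by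
  simp [stellar]

theorem subsets_triple_nodup {a b c : ℕ} (hab : a ≠ b) (hac : a ≠ c) (hbc : b ≠ c) :
    ([∅, {a}, {b}, {c}, {a, b}, {a, c}, {b, c}] : List (Finset ℕ)).Nodup := by
  have h1 : ∀ x y z : ℕ, x ≠ y → ({z} : Finset ℕ) ≠ {x, y} := by
    intro x y z h h'
    have := congrArg Finset.card h'
    rw [Finset.card_pair h] at this
    simp at this
  have h2 : ({a, b} : Finset ℕ) ≠ {a, c} := by
    intro h
    have : b ∈ ({a, c} : Finset ℕ) := h ▸ (by simp)
    grind
  have h3 : ({a, b} : Finset ℕ) ≠ {b, c} := by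
    intro h
    have : a ∈ ({b, c} : Finset ℕ) := h ▸ (by simp)
    grind
  have h4 : ({a, c} : Finset ℕ) ≠ {b, c} := by
    intro h
    have : a ∈ ({b, c} : Finset ℕ) := h ▸ (by simp)
    grind
  have h5 : ∀ s : Finset ℕ, s.Nonempty → ∅ ≠ s := fun s h h' => by simp [← h'] at h
  simp [h1, h2, h3, h4, h5, hab, hac, hbc]

theorem ssubsets_triple {a b c : ℕ} (hab : a ≠ b) (hac : a ≠ c) (hbc : b ≠ c) :
    ({a, b, c} : Finset ℕ).ssubsets
      = [∅, {a}, {b}, {c}, {a, b}, {a, c}, {b, c}].toFinset := by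
  symm
  apply Finset.eq_of_subset_of_card_le
  · intro σ hσ
    rw [Finset.mem_ssubsets, Finset.ssubset_iff_subset_ne]
    simp only [List.mem_toFinset, List.mem_cons, List.not_mem_nil, or_false] at hσ
    have hc : ({a, b, c} : Finset ℕ).card = 3 := Finset.card_eq_three.2 ⟨a, b, c, hab, hac, hbc, rfl⟩
    rcases hσ with rfl | rfl | rfl | rfl | rfl | rfl | rfl
    all_goals
      refine ⟨by grind, fun h => ?_⟩
      rw [← h] at hc
      first
        | simp at hc
        | exact absurd hc (by have := Finset.card_le_two (a := a) (b := b); omega)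
        | exact absurd hc (by have := Finset.card_le_two (a := a) (b := c); omega)
        | exact absurd hc (by have := Finset.card_le_two (a := b) (b := c); omega)
  · rw [Finset.ssubsets, Finset.card_erase_of_mem (Finset.mem_powerset_self _),
      Finset.card_powerset, Finset.card_eq_three.2 ⟨a, b, c, hab, hac, hbc, rfl⟩,
      List.toFinset_card_of_nodup (subsets_triple_nodup hab hac hbc)]
    simp

theorem sum_stellar {K : Finset (Finset ℕ)} {a b c v : ℕ} (hab : a ≠ b) (hac : a ≠ c) (hbc : b ≠ c)
    (hf : {a, b, c} ∈ K) (hv : ∀ σ ∈ K, v ∉ σ) (g : Finset ℕ → ℕ) :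
    ∑ σ ∈ stellar K {a, b, c} v, g σ + g {a, b, c} = ∑ σ ∈ K, g σ + (g {v}
      + (g {v, a} + g {v, b} + g {v, c}) + (g {v, a, b} + g {v, a, c} + g {v, b, c})) := by
  have hdisj : Disjoint (K.erase {a, b, c}) (({a, b, c} : Finset ℕ).ssubsets.image (insert v)) := by
    rw [Finset.disjoint_left]
    intro σ hσ hσ'
    obtain ⟨τ, -, rfl⟩ := Finset.mem_image.1 hσ'
    exact hv _ (Finset.mem_of_mem_erase hσ) (Finset.mem_insert_self _ _)
  have hvf := hv _ hf
  have hinj : Set.InjOn (insert v) (({a, b, c} : Finset ℕ).ssubsets : Set (Finset ℕ)) := by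
    intro τ hτ τ' hτ' h
    have h1 : v ∉ τ := fun h => hvf ((Finset.mem_ssubsets.1 hτ).1 h)
    have h2 : v ∉ τ' := fun h => hvf ((Finset.mem_ssubsets.1 hτ').1 h)
    rw [← Finset.erase_insert h1, ← Finset.erase_insert h2]
    exact congrArg (fun s => Finset.erase s v) h
  rw [stellar, Finset.sum_union hdisj, Finset.sum_image hinj, ssubsets_triple hab hac hbc,
    ← Finset.add_sum_erase K g hf]
  rw [List.sum_toFinset _ (subsets_triple_nodup hab hac hbc)]
  simp only [List.map_cons, List.map_nil, List.sum_cons, List.sum_nil, insert_empty_eq]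
  omega

namespace Tiling

variable {P : ℕ → ℂ} {K : Finset (Finset ℕ)} {o : Finset ℕ}

/-- The open cells of a tiling are pairwise disjoint. -/
theorem eq_of_mem_cell (T : Tiling P K o) {σ τ : Finset ℕ} (hσ : σ ∈ K) (hτ : τ ∈ K) {z : ℂ}
    (h1 : z ∈ cell P σ) (h2 : z ∈ cell P τ) : σ = τ := by
  by_contra hne
  have h := T.partitions z
  rw [← Finset.add_sum_erase K _ hσ, ← Finset.add_sum_erase (K.erase σ) _
    (Finset.mem_erase.2 ⟨Ne.symm hne, hτ⟩)] at h
  rw [ind, if_pos h1, ind, if_pos h2] at h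
  omega

theorem mem_convexHull_of_mem_cell (T : Tiling P K o) {σ : Finset ℕ} (hσ : σ ∈ K) {z : ℂ}
    (h1 : z ∈ cell P σ) : z ∈ convexHull ℝ (P '' o) := by
  by_contra hne
  have h := T.partitions z
  rw [← Finset.add_sum_erase K _ hσ, ind, if_pos h1] at h
  rw [ind, if_pos (show z ∈ (convexHull ℝ (P '' (o : Set ℕ)))ᶜ from hne)] at h
  omega

theorem exists_mem_cell (T : Tiling P K o) {z : ℂ} (hz : z ∈ convexHull ℝ (P '' o)) :
    ∃ σ ∈ K, z ∈ cell P σ := by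
  by_contra! hne
  have h := T.partitions z
  have h0 : ∀ σ ∈ K, ind (cell P σ) z = 0 := fun σ hσ => if_neg (hne σ hσ)
  have h1 : ind (convexHull ℝ (P '' (o : Set ℕ)))ᶜ z = 0 := if_neg fun h => h hz
  rw [Finset.sum_eq_zero h0, h1] at h
  omega

theorem pos_inj (T : Tiling P K o) {i j : ℕ} (hi : {i} ∈ K) (hj : {j} ∈ K) (h : P i = P j) :
    i = j := by
  have := T.eq_of_mem_cell hi hj (z := P i) (by rw [cell_singleton]; rfl)
    (by rw [cell_singleton, h]; rfl)
  exact Finset.singleton_inj.1 this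

/-- The corners of a triangle of a tiling are not collinear, since otherwise one of them would lie
in the open segment joining the two others. -/
theorem orient_ne_zero (T : Tiling P K o) {i j k : ℕ} (hij : i ≠ j) (hik : i ≠ k) (hjk : j ≠ k)
    (hf : {i, j, k} ∈ K) : orient (P i) (P j) (P k) ≠ 0 := by
  have hi : {i} ∈ K := T.down _ hf _ (by simp) (by simp)
  have hj : {j} ∈ K := T.down _ hf _ (by simp) (by simp)
  have hk : {k} ∈ K := T.down _ hf _ (by simp) (by simp)
  have key : ∀ x y z : ℕ, x ≠ y → {x, y} ∈ K → {z} ∈ K →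
      P z ∉ openSegment ℝ (P x) (P y) := by
    intro x y z hxy h1 h2 hm
    rw [← cell_pair P hxy] at hm
    have := congrArg Finset.card (T.eq_of_mem_cell h1 h2 hm (by rw [cell_singleton]; rfl))
    rw [Finset.card_pair hxy] at this
    simp at this
  have nij : P i ≠ P j := fun h => hij (T.pos_inj hi hj h)
  have nik : P i ≠ P k := fun h => hik (T.pos_inj hi hk h)
  have njk : P j ≠ P k := fun h => hjk (T.pos_inj hj hk h)
  have k1 := key i j k hij (T.down _ hf _ (by grind) (by simp)) hk
  have k2 := key k j i hjk.symm (T.down _ hf _ (by grind) (by simp)) hi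
  have k3 := key i k j hik (T.down _ hf _ (by grind) (by simp)) hj
  intro h0
  have hd : P j - P i ≠ 0 := sub_ne_zero.2 nij.symm
  obtain ⟨t, ht⟩ : ∃ t : ℝ, P k = P i + t • (P j - P i) := by
    refine ⟨((P k - P i) / (P j - P i)).re, ?_⟩
    have him : ((P k - P i) / (P j - P i)).im = 0 := by
      rw [Complex.div_im]
      simp only [orient, cross] at h0
      rw [← sub_div, div_eq_zero_iff]
      left
      linarith
    have : (P k - P i) / (P j - P i) = (((P k - P i) / (P j - P i)).re : ℂ) :=
      Complex.ext rfl (by simpa using him)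
    rw [Complex.real_smul, ← this, div_mul_cancel₀ _ hd]
    ring
  rw [ht] at k1 k2 k3 nik njk
  rw [mem_openSegment_iff_smul] at k1 k2 k3
  rcases lt_trichotomy t 0 with h | h | h
  · refine k2 ⟨-t / (1 - t), ⟨div_pos (by linarith) (by linarith), ?_⟩, ?_⟩
    · rw [div_lt_one (by linarith)]; linarith
    · have : P j - (P i + t • (P j - P i)) = (1 - t) • (P j - P i) := by module
      rw [this, smul_smul, div_mul_cancel₀ _ (by linarith)]
      module
  · exact nik (by rw [h]; simp)
  · rcases lt_trichotomy t 1 with h' | h' | h'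
    · exact k1 ⟨t, ⟨h, h'⟩, rfl⟩
    · exact njk (by rw [h']; simp)
    · refine k3 ⟨1 / t, ⟨by positivity, by rwa [div_lt_one h]⟩, ?_⟩
      rw [add_sub_cancel_left, smul_smul, div_mul_cancel₀ _ h.ne']
      module

/-- Joining a new vertex placed inside a triangle of a tiling to its three corners. -/
theorem insert_vertex (T : Tiling P K o) {a b c v : ℕ} (hab : a ≠ b) (hac : a ≠ c) (hbc : b ≠ c)
    (hf : {a, b, c} ∈ K) (hv : ∀ σ ∈ K, v ∉ σ)
    (hp : P v ∈ openTriangle (P a) (P b) (P c)) : Tiling P (stellar K {a, b, c} v) o where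
  nonempty := by
    intro σ hσ
    rcases mem_stellar.1 hσ with ⟨-, h⟩ | ⟨τ, -, rfl⟩
    · exact T.nonempty _ h
    · simp
  card_le := by
    have hfo := Finset.card_eq_three.2 ⟨a, b, c, hab, hac, hbc, rfl⟩
    intro σ hσ
    rcases mem_stellar.1 hσ with ⟨-, h⟩ | ⟨τ, hτ, rfl⟩
    · exact T.card_le _ h
    · have := Finset.card_lt_card hτ
      have := Finset.card_insert_le v τ
      omega
  down := by
    intro σ hσ τ hτ hne
    have hfo := Finset.card_eq_three.2 ⟨a, b, c, hab, hac, hbc, rfl⟩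
    rw [mem_stellar] at hσ ⊢
    rcases hσ with ⟨h1, h2⟩ | ⟨ρ, hρ, rfl⟩
    · refine Or.inl ⟨?_, T.down _ h2 _ hτ hne⟩
      rintro rfl
      exact h1 (Finset.eq_of_subset_of_card_le hτ (by have := T.card_le _ h2; omega)).symm
    · by_cases hvτ : v ∈ τ
      · refine Or.inr ⟨τ.erase v, ?_, Finset.insert_erase hvτ⟩
        refine lt_of_le_of_lt ?_ hρ
        exact Finset.subset_insert_iff.1 hτ
      · have hτρ : τ ⊆ ρ := (Finset.subset_insert_iff_of_notMem hvτ).1 hτ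
        have := lt_of_le_of_lt hτρ hρ
        exact Or.inl ⟨this.ne, T.down _ hf _ this.le hne⟩
  outer_card := T.outer_card
  outer_edges := by
    intro τ hτ h2
    have hfo := Finset.card_eq_three.2 ⟨a, b, c, hab, hac, hbc, rfl⟩
    refine mem_stellar.2 (Or.inl ⟨?_, T.outer_edges τ hτ h2⟩)
    rintro rfl
    omega
  partitions := by
    intro z
    have hvf := hv _ hf
    simp only [Finset.mem_insert, Finset.mem_singleton, not_or] at hvf
    have h1 := sum_stellar hab hac hbc hf hv fun σ => ind (cell P σ) z
    have h2 := ind_openTriangle_star (T.orient_ne_zero hab hac hbc hf) hp z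
    have h3 := T.partitions z
    rw [cell_triple P hab hac hbc, cell_triple P hvf.1 hvf.2.1 hab,
      cell_triple P hvf.1 hvf.2.2 hac, cell_triple P hvf.2.1 hvf.2.2 hbc, cell_pair P hvf.1,
      cell_pair P hvf.2.1, cell_pair P hvf.2.2, cell_singleton] at h1
    omega

end Tiling

/-! ### Topology of triangles and their complements -/

theorem mem_convexHull_triple {a b c z : ℂ} : z ∈ convexHull ℝ {a, b, c} ↔
    ∃ x y w : ℝ, 0 ≤ x ∧ 0 ≤ y ∧ 0 ≤ w ∧ x + y + w = 1 ∧ x • a + y • b + w • c = z := by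
  rw [convexHull_insert (by simp), convexHull_pair]
  simp only [mem_convexJoin, Set.mem_singleton_iff, exists_eq_left]
  constructor
  · rintro ⟨_, ⟨s, t, hs, ht, hst, rfl⟩, ⟨x, y, hx, hy, hxy, rfl⟩⟩
    exact ⟨x, y * s, y * t, hx, by positivity, by positivity,
      by linear_combination hxy + y * hst, by module⟩
  · rintro ⟨x, y, w, hx, hy, hw, h1, rfl⟩
    rcases eq_or_lt_of_le (add_nonneg hy hw) with h | h
    · obtain rfl : y = 0 := by linarith
      obtain rfl : w = 0 := by linarith
      obtain rfl : x = 1 := by linarith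
      exact ⟨b, left_mem_segment ℝ b c, by simpa using left_mem_segment ℝ a b⟩
    · refine ⟨(y / (y + w)) • b + (w / (y + w)) • c,
        ⟨_, _, by positivity, by positivity, by field_simp, rfl⟩, x, y + w, hx, h.le,
        by linarith, ?_⟩
      rw [smul_add, smul_smul, smul_smul, mul_div_cancel₀ _ h.ne', mul_div_cancel₀ _ h.ne',
        add_assoc]

theorem isOpen_openTriangle {a b c : ℂ} (h : orient a b c ≠ 0) : IsOpen (openTriangle a b c) := by
  have : openTriangle a b c = {z | 0 < orient a z c / orient a b c} ∩
      {z | 0 < orient a b z / orient a b c} ∩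
      {z | 0 < 1 - orient a z c / orient a b c - orient a b z / orient a b c} := by
    ext z
    constructor
    · rintro ⟨x, y, w, hx, hy, hw, h1, rfl⟩
      obtain rfl : x = 1 - y - w := by linarith
      have e1 : orient a ((1 - y - w) • a + y • b + w • c) c = y * orient a b c := by
        simp [orient, cross]; ring
      have e2 : orient a b ((1 - y - w) • a + y • b + w • c) = w * orient a b c := by
        simp [orient, cross]; ring
      simp only [Set.mem_inter_iff, Set.mem_ofPred_eq, e1, e2, mul_div_cancel_right₀ _ h]
      exact ⟨⟨hy, hw⟩, hx⟩
    · rintro ⟨⟨hy, hw⟩, hx⟩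
      refine ⟨_, _, _, hx, hy, hw, by ring, ?_⟩
      apply Complex.ext <;> simp <;> field_simp <;> simp [orient, cross] <;> ring
  rw [this]
  refine (IsOpen.inter ?_ ?_).inter ?_ <;> refine isOpen_lt continuous_const ?_ <;>
    simp only [orient, cross] <;> fun_prop

theorem openTriangle_subset_convexHull (a b c : ℂ) :
    openTriangle a b c ⊆ convexHull ℝ {a, b, c} := by
  rintro z ⟨x, y, w, hx, hy, hw, h⟩
  exact mem_convexHull_triple.2 ⟨x, y, w, hx.le, hy.le, hw.le, h⟩

theorem interior_convexHull_triple {a b c : ℂ} (h : orient a b c ≠ 0) :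
    interior (convexHull ℝ {a, b, c}) = openTriangle a b c := by
  apply Set.Subset.antisymm
  · -- A point of the interior can be moved a little in the directions parallel to the sides.
    intro z hz
    have key : ∀ d : ℂ, ∃ ε : ℝ, 0 < ε ∧ z + ε • d ∈ convexHull ℝ {a, b, c} := by
      intro d
      have hc : Filter.Tendsto (fun ε : ℝ => z + ε • d) (nhdsWithin 0 (Set.Ioi 0)) (nhds z) := by
        have : Continuous fun ε : ℝ => z + ε • d := by fun_prop
        simpa using (this.tendsto 0).mono_left nhdsWithin_le_nhds
      obtain ⟨ε, h1, h2⟩ := ((hc.eventually (mem_interior_iff_mem_nhds.1 hz)).and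
        self_mem_nhdsWithin).exists
      exact ⟨ε, h2, h1⟩
    obtain ⟨x, y, w, -, -, -, h1, rfl⟩ := mem_convexHull_triple.1 (interior_subset hz)
    refine ⟨x, y, w, ?_, ?_, ?_, h1, rfl⟩
    · obtain ⟨ε, hε, hm⟩ := key (b - a)
      obtain ⟨x', y', w', hx, hy, hw, h1', he⟩ := mem_convexHull_triple.1 hm
      have := barycentric_unique h (x := x - ε) (y := y + ε) (w := w) (by linarith) h1'
        (by rw [he]; module)
      linarith [this.1]
    · obtain ⟨ε, hε, hm⟩ := key (a - b)
      obtain ⟨x', y', w', hx, hy, hw, h1', he⟩ := mem_convexHull_triple.1 hm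
      have := barycentric_unique h (x := x + ε) (y := y - ε) (w := w) (by linarith) h1'
        (by rw [he]; module)
      linarith [this.2.1]
    · obtain ⟨ε, hε, hm⟩ := key (a - c)
      obtain ⟨x', y', w', hx, hy, hw, h1', he⟩ := mem_convexHull_triple.1 hm
      have := barycentric_unique h (x := x + ε) (y := y) (w := w - ε) (by linarith) h1'
        (by rw [he]; module)
      linarith [this.2.2]
  · exact interior_maximal (openTriangle_subset_convexHull a b c) (isOpen_openTriangle h)

theorem isBounded_convexHull_image (P : ℕ → ℂ) (s : Finset ℕ) :
    Bornology.IsBounded (convexHull ℝ (P '' s)) :=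
  isBounded_convexHull.2 (s.finite_toSet.image P).isBounded

/-- The complement of a bounded convex set in the plane is connected: every point outside is joined
to a large circle by a segment of a ray that starts at a point of the set. -/
theorem isPreconnected_compl_of_convex {C : Set ℂ} (hC : Convex ℝ C)
    (hb : Bornology.IsBounded C) : IsPreconnected Cᶜ := by
  rcases C.eq_empty_or_nonempty with rfl | ⟨q, hq⟩
  · simpa using isPreconnected_univ
  obtain ⟨R, hR⟩ := hb.subset_closedBall q
  obtain ⟨S, hS0, hRS⟩ : ∃ S : ℝ, 0 < S ∧ R < S := ⟨max R 0 + 1, by positivity,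
    lt_of_le_of_lt (le_max_left _ _) (lt_add_one _)⟩
  have hsph : Metric.sphere q S ⊆ Cᶜ := by
    intro z hz hzC
    have h1 := hR hzC
    rw [Metric.mem_closedBall] at h1
    rw [Metric.mem_sphere] at hz
    linarith
  have hconn : IsPreconnected (Metric.sphere q S) :=
    isPreconnected_sphere (by simp) q S
  apply isPreconnected_of_forall (q + S)
  intro z hz
  have hzq : z - q ≠ 0 := sub_ne_zero.2 fun h => hz (h ▸ hq)
  have hn : 0 < ‖z - q‖ := norm_pos_iff.2 hzq
  have hp : q + (S / ‖z - q‖) • (z - q) ∈ Metric.sphere q S := by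
    rw [mem_sphere_iff_norm, add_sub_cancel_left, norm_smul, Real.norm_of_nonneg (by positivity),
      div_mul_cancel₀ _ hn.ne']
  refine ⟨Metric.sphere q S ∪ segment ℝ z (q + (S / ‖z - q‖) • (z - q)), ?_,
    Or.inl (by simp [abs_of_pos hS0]), Or.inr (left_mem_segment _ _ _),
    hconn.union _ hp (right_mem_segment _ _ _) (convex_segment _ _).isPreconnected⟩
  refine Set.union_subset hsph ?_
  -- Points of the segment lie on the ray from `q` through `z`, at least as far as the nearer end.
  have hray : ∀ r : ℝ, 1 ≤ r → ∀ x ∉ C, q + r • (x - q) ∉ C := by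
    intro r hr x hx hm
    have hr0 : 0 < r := by linarith
    refine hx ?_
    have := hC hq hm (a := 1 - 1 / r) (b := 1 / r) (by
      rw [sub_nonneg, div_le_one hr0]; exact hr) (by positivity) (by ring)
    convert this using 1
    rw [smul_add, smul_smul, one_div_mul_cancel hr0.ne']
    module
  rintro x ⟨u, v, hu, hv, huv, rfl⟩
  obtain rfl : u = 1 - v := by linarith
  rcases le_total 1 (S / ‖z - q‖) with h | h
  · have : (1 - v) • z + v • (q + (S / ‖z - q‖) • (z - q))
        = q + (1 + v * (S / ‖z - q‖ - 1)) • (z - q) := by module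
    rw [this]
    exact hray _ (by nlinarith) z hz
  · have hS' : 0 < S / ‖z - q‖ := by positivity
    have : (1 - v) • z + v • (q + (S / ‖z - q‖) • (z - q))
        = q + (v + (1 - v) / (S / ‖z - q‖)) • (q + (S / ‖z - q‖) • (z - q) - q) := by
      rw [add_sub_cancel_left, smul_smul, add_mul, div_mul_cancel₀ _ hS'.ne']
      module
    rw [this]
    refine hray _ ?_ _ (hsph hp)
    have : 1 - v ≤ (1 - v) / (S / ‖z - q‖) := by
      rw [le_div_iff₀ hS']; nlinarith
    linarith

/-- A member of a partition into two open sets, the first of them connected, is a component. -/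
theorem connectedComponentIn_eq_of_isOpen {X : Type*} [TopologicalSpace X] {S U V : Set X} {z : X}
    (hU : IsOpen U) (hV : IsOpen V) (hUV : Disjoint U V) (hS : S = U ∪ V) (hc : IsPreconnected U)
    (hz : z ∈ U) : connectedComponentIn S z = U := by
  have hzS : z ∈ S := hS ▸ Or.inl hz
  apply Set.Subset.antisymm
  · exact isPreconnected_connectedComponentIn.subset_left_of_subset_union hU hV hUV
      (hS ▸ connectedComponentIn_subset S z) ⟨z, mem_connectedComponentIn hzS, hz⟩
  · exact hc.subset_connectedComponentIn hz (hS ▸ Set.subset_union_left)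

/-- The closed triangle is the disjoint union of its corners, open sides and interior. -/
theorem ind_compl_convexHull_triple {a b c : ℂ} (h : orient a b c ≠ 0) (z : ℂ) :
    ind {a} z + ind {b} z + ind {c} z + (ind (openSegment ℝ a b) z + ind (openSegment ℝ a c) z
      + ind (openSegment ℝ b c) z) + ind (openTriangle a b c) z
      + ind (convexHull ℝ {a, b, c})ᶜ z = 1 := by
  obtain ⟨x, y, w, h1, rfl⟩ := exists_barycentric h z
  have ha : x • a + y • b + w • c ∈ ({a} : Set ℂ) ↔ 0 < x ∧ y = 0 ∧ w = 0 := by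
    rw [Set.mem_singleton_iff]
    constructor
    · intro he
      obtain ⟨rfl, rfl, rfl⟩ := barycentric_unique h (x' := 1) (y' := 0) (w' := 0) h1 (by simp)
        (by rw [he]; simp)
      simp
    · rintro ⟨-, rfl, rfl⟩
      obtain rfl : x = 1 := by linarith
      simp
  have hb : x • a + y • b + w • c ∈ ({b} : Set ℂ) ↔ x = 0 ∧ 0 < y ∧ w = 0 := by
    rw [Set.mem_singleton_iff]
    constructor
    · intro he
      obtain ⟨rfl, rfl, rfl⟩ := barycentric_unique h (x' := 0) (y' := 1) (w' := 0) h1 (by simp)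
        (by rw [he]; simp)
      simp
    · rintro ⟨rfl, -, rfl⟩
      obtain rfl : y = 1 := by linarith
      simp
  have hc : x • a + y • b + w • c ∈ ({c} : Set ℂ) ↔ x = 0 ∧ y = 0 ∧ 0 < w := by
    rw [Set.mem_singleton_iff]
    constructor
    · intro he
      obtain ⟨rfl, rfl, rfl⟩ := barycentric_unique h (x' := 0) (y' := 0) (w' := 1) h1 (by simp)
        (by rw [he]; simp)
      simp
    · rintro ⟨rfl, rfl, -⟩
      obtain rfl : w = 1 := by linarith
      simp
  have hab : x • a + y • b + w • c ∈ openSegment ℝ a b ↔ 0 < x ∧ 0 < y ∧ w = 0 := by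
    constructor
    · rintro ⟨s, t, hs, ht, hst, he⟩
      obtain ⟨rfl, rfl, rfl⟩ := barycentric_unique h (x := s) (y := t) (w := 0) (by linarith) h1
        (by rw [← he]; simp)
      simp [hs, ht]
    · rintro ⟨hx, hy, rfl⟩
      exact ⟨x, y, hx, hy, by linarith, by simp⟩
  have hac : x • a + y • b + w • c ∈ openSegment ℝ a c ↔ 0 < x ∧ y = 0 ∧ 0 < w := by
    constructor
    · rintro ⟨s, t, hs, ht, hst, he⟩
      obtain ⟨rfl, rfl, rfl⟩ := barycentric_unique h (x := s) (y := 0) (w := t) (by linarith) h1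
        (by rw [← he]; simp)
      simp [hs, ht]
    · rintro ⟨hx, rfl, hw⟩
      exact ⟨x, w, hx, hw, by linarith, by simp⟩
  have hbc : x • a + y • b + w • c ∈ openSegment ℝ b c ↔ x = 0 ∧ 0 < y ∧ 0 < w := by
    constructor
    · rintro ⟨s, t, hs, ht, hst, he⟩
      obtain ⟨rfl, rfl, rfl⟩ := barycentric_unique h (x := 0) (y := s) (w := t) (by linarith) h1
        (by rw [← he]; simp)
      simp [hs, ht]
    · rintro ⟨rfl, hy, hw⟩
      exact ⟨y, w, hy, hw, by linarith, by simp⟩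
  have habc : x • a + y • b + w • c ∈ openTriangle a b c ↔ 0 < x ∧ 0 < y ∧ 0 < w := by
    constructor
    · rintro ⟨x', y', w', hx, hy, hw, h1', he⟩
      obtain ⟨rfl, rfl, rfl⟩ := barycentric_unique h h1' h1 he
      exact ⟨hx, hy, hw⟩
    · rintro ⟨hx, hy, hw⟩
      exact ⟨x, y, w, hx, hy, hw, h1, rfl⟩
  have hout : x • a + y • b + w • c ∈ (convexHull ℝ {a, b, c})ᶜ ↔
      ¬ (0 ≤ x ∧ 0 ≤ y ∧ 0 ≤ w) := by
    rw [Set.mem_compl_iff, mem_convexHull_triple, not_iff_not]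
    constructor
    · rintro ⟨x', y', w', hx, hy, hw, h1', he⟩
      obtain ⟨rfl, rfl, rfl⟩ := barycentric_unique h h1' h1 he
      exact ⟨hx, hy, hw⟩
    · rintro ⟨hx, hy, hw⟩
      exact ⟨x, y, w, hx, hy, hw, h1, rfl⟩
  simp only [ind, ha, hb, hc, hab, hac, hbc, habc, hout]
  rcases lt_trichotomy x 0 with hx | rfl | hx <;> rcases lt_trichotomy y 0 with hy | rfl | hy <;>
    rcases lt_trichotomy w 0 with hw | rfl | hw <;>
    simp_all [le_of_lt, not_lt_of_gt, ne_of_gt, ne_of_lt]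

/-! ### The geometric graph of a tiling -/

/-- The geometric graph on the first `n` points of `P` whose edges are the two-element members of
`K`. -/
def tilingGraph (P : ℕ → ℂ) (K : Finset (Finset ℕ)) (n : ℕ)
    (hP : Function.Injective fun i : Fin n => P i) : GeometricGraph (Fin n) where
  graph :=
    { Adj := fun i j => i ≠ j ∧ {(i : ℕ), (j : ℕ)} ∈ K
      symm := ⟨fun i j h => ⟨h.1.symm, by rw [Finset.pair_comm]; exact h.2⟩⟩
      loopless := ⟨fun i h => h.1 rfl⟩ }
  pos := fun i => P i
  pos_injective := hP

namespace Tiling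

variable {P : ℕ → ℂ} {K : Finset (Finset ℕ)} {o : Finset ℕ} {n : ℕ}

theorem injective (T : Tiling P K o) (hn : ∀ i, {i} ∈ K ↔ i < n) :
    Function.Injective fun i : Fin n => P i := fun i j h =>
  Fin.ext (T.pos_inj ((hn i).2 i.2) ((hn j).2 j.2) h)

theorem lt_of_mem (T : Tiling P K o) (hn : ∀ i, {i} ∈ K ↔ i < n) {σ : Finset ℕ} (hσ : σ ∈ K)
    {i : ℕ} (hi : i ∈ σ) : i < n :=
  (hn i).1 (T.down _ hσ _ (by simpa using hi) (by simp))

theorem segment_eq {a b : ℂ} : segment ℝ a b = {a, b} ∪ openSegment ℝ a b := by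
  rw [← insert_endpoints_openSegment]
  ext; simp [or_assoc]

theorem isPlane (T : Tiling P K o) (hn : ∀ i, {i} ∈ K ↔ i < n)
    (hP : Function.Injective fun i : Fin n => P i) : (tilingGraph P K n hP).IsPlane := by
  have hvert : ∀ u v w : Fin n, (tilingGraph P K n hP).graph.Adj u v →
      P w ∉ openSegment ℝ (P u) (P v) := by
    rintro u v w ⟨hne, h⟩ hw
    have hne' : (u : ℕ) ≠ v := fun h => hne (Fin.ext h)
    rw [← cell_pair P hne'] at hw
    have := T.eq_of_mem_cell h ((hn w).2 w.2) hw (by rw [cell_singleton]; rfl)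
    have := congrArg Finset.card this
    rw [Finset.card_pair hne'] at this
    simp at this
  refine ⟨?_, ?_⟩
  · intro u v w h hw
    have hw' : P w ∈ segment ℝ (P u) (P v) := hw
    rw [segment_eq] at hw'
    rcases hw' with (hw' | hw') | hw'
    · exact Or.inl (hP hw')
    · exact Or.inr (hP hw')
    · exact absurd hw' (hvert u v w h)
  · rintro u v x y huv hxy hne z ⟨h1, h2⟩
    have h1' : z ∈ segment ℝ (P u) (P v) := h1
    have h2' : z ∈ segment ℝ (P x) (P y) := h2
    rw [segment_eq] at h1' h2'
    have hend : ∀ a b : Fin n, z ∈ ({P a, P b} : Set ℂ) → ∃ c, (c = a ∨ c = b) ∧ P c = z := by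
      rintro a b (h | h)
      · exact ⟨a, Or.inl rfl, h.symm⟩
      · exact ⟨b, Or.inr rfl, h.symm⟩
    rcases h1' with h1' | h1' <;> rcases h2' with h2' | h2'
    · obtain ⟨c, hc, hcz⟩ := hend u v h1'
      obtain ⟨d, hd, hdz⟩ := hend x y h2'
      obtain rfl : c = d := hP (hcz.trans hdz.symm)
      exact ⟨c, ⟨by simpa using hc, by simpa using hd⟩, hcz⟩
    · obtain ⟨c, hc, rfl⟩ := hend u v h1'
      exact absurd h2' (hvert x y c hxy)
    · obtain ⟨c, hc, rfl⟩ := hend x y h2'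
      exact absurd h1' (hvert u v c huv)
    · rw [← cell_pair P fun h => huv.1 (Fin.ext h)] at h1'
      rw [← cell_pair P fun h => hxy.1 (Fin.ext h)] at h2'
      have h := T.eq_of_mem_cell huv.2 hxy.2 h1' h2'
      refine absurd ?_ hne
      have hu : (u : ℕ) ∈ ({(x : ℕ), (y : ℕ)} : Finset ℕ) := h ▸ (by simp)
      have hv : (v : ℕ) ∈ ({(x : ℕ), (y : ℕ)} : Finset ℕ) := h ▸ (by simp)
      have := huv.1
      simp only [Finset.mem_insert, Finset.mem_singleton, ← Fin.ext_iff] at hu hv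
      rw [Sym2.eq_iff]
      grind

theorem mem_drawing_iff (T : Tiling P K o) (hn : ∀ i, {i} ∈ K ↔ i < n)
    (hP : Function.Injective fun i : Fin n => P i) (z : ℂ) :
    z ∈ (tilingGraph P K n hP).drawing ↔ ∃ σ ∈ K, σ.card ≤ 2 ∧ z ∈ cell P σ := by
  constructor
  · rintro (⟨i, rfl⟩ | ⟨u, v, h, hz⟩)
    · exact ⟨{(i : ℕ)}, (hn i).2 i.2, by simp, by rw [cell_singleton]; rfl⟩
    · have hz' : z ∈ segment ℝ (P u) (P v) := hz
      rw [segment_eq] at hz'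
      rcases hz' with (rfl | rfl) | hz'
      · exact ⟨{(u : ℕ)}, (hn u).2 u.2, by simp, by rw [cell_singleton]; rfl⟩
      · exact ⟨{(v : ℕ)}, (hn v).2 v.2, by simp, by rw [cell_singleton]; rfl⟩
      · exact ⟨_, h.2, Finset.card_le_two, by rwa [cell_pair P fun h' => h.1 (Fin.ext h')]⟩
  · rintro ⟨σ, hσ, hc, hz⟩
    have h0 := (T.nonempty σ hσ).card_pos
    have h12 : σ.card = 1 ∨ σ.card = 2 := by omega
    rcases h12 with h | h
    · obtain ⟨i, rfl⟩ := Finset.card_eq_one.1 h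
      rw [cell_singleton] at hz
      exact Or.inl ⟨⟨i, (hn i).1 hσ⟩, hz.symm⟩
    · obtain ⟨i, j, hij, rfl⟩ := Finset.card_eq_two.1 h
      rw [cell_pair P hij] at hz
      exact Or.inr ⟨⟨i, T.lt_of_mem hn hσ (by simp)⟩, ⟨j, T.lt_of_mem hn hσ (by simp)⟩,
        ⟨fun h => hij (Fin.ext_iff.1 h), hσ⟩, openSegment_subset_segment _ _ _ hz⟩

theorem exists_triangle (T : Tiling P K o) (hn : ∀ i, {i} ∈ K ↔ i < n)
    (hP : Function.Injective fun i : Fin n => P i) {σ : Finset ℕ} (h3 : σ.card = 3)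
    (hσ : ∀ τ ⊆ σ, τ.card = 2 → τ ∈ K) :
    ∃ a b c : Fin n, (tilingGraph P K n hP).Is3Cycle a b c ∧ σ = {(a : ℕ), (b : ℕ), (c : ℕ)} ∧
      (tilingGraph P K n hP).triangle a b c = convexHull ℝ (P '' σ) := by
  obtain ⟨i, j, k, hij, hik, hjk, rfl⟩ := Finset.card_eq_three.1 h3
  have e1 := hσ {i, j} (by grind) (Finset.card_pair hij)
  have e2 := hσ {i, k} (by grind) (Finset.card_pair hik)
  have e3 := hσ {j, k} (by grind) (Finset.card_pair hjk)
  refine ⟨⟨i, T.lt_of_mem hn e1 (by simp)⟩, ⟨j, T.lt_of_mem hn e1 (by simp)⟩,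
    ⟨k, T.lt_of_mem hn e2 (by simp)⟩, ⟨⟨?_, e1⟩, ⟨?_, e3⟩, ⟨?_, e2⟩⟩, rfl, ?_⟩
  · simpa [Fin.ext_iff] using hij
  · simpa [Fin.ext_iff] using hjk
  · simpa [Fin.ext_iff] using hik
  · simp [GeometricGraph.triangle, tilingGraph, Set.image_insert_eq]

theorem isOpen_cell (T : Tiling P K o) {σ : Finset ℕ} (hσ : σ ∈ K) (h3 : σ.card = 3) :
    IsOpen (cell P σ) := by
  obtain ⟨i, j, k, hij, hik, hjk, rfl⟩ := Finset.card_eq_three.1 h3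
  rw [cell_triple P hij hik hjk]
  exact isOpen_openTriangle (T.orient_ne_zero hij hik hjk hσ)

theorem cell_eq_interior (T : Tiling P K o) {σ : Finset ℕ} (hσ : σ ∈ K) (h3 : σ.card = 3) :
    cell P σ = interior (convexHull ℝ (P '' σ)) := by
  obtain ⟨i, j, k, hij, hik, hjk, rfl⟩ := Finset.card_eq_three.1 h3
  rw [cell_triple P hij hik hjk, ← interior_convexHull_triple (T.orient_ne_zero hij hik hjk hσ)]
  simp [Set.image_insert_eq]

/-- The faces of the graph of a tiling are the open triangles and the complement of the outer
triangle. -/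
theorem face_cases (T : Tiling P K o) (hn : ∀ i, {i} ∈ K ↔ i < n)
    (hP : Function.Injective fun i : Fin n => P i) {F : Set ℂ}
    (hF : (tilingGraph P K n hP).IsFace F) :
    (∃ σ ∈ K, σ.card = 3 ∧ F = cell P σ) ∨ F = (convexHull ℝ (P '' o))ᶜ := by
  obtain ⟨z, hz, rfl⟩ := hF
  have hcompact : IsClosed (convexHull ℝ (P '' (o : Set ℕ))) :=
    (o.finite_toSet.image P).isClosed_convexHull ℝ
  have hnd : ∀ x, x ∈ (tilingGraph P K n hP).drawingᶜ ↔
      (∃ σ ∈ K, σ.card = 3 ∧ x ∈ cell P σ) ∨ x ∈ (convexHull ℝ (P '' (o : Set ℕ)))ᶜ := by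
    intro x
    rw [Set.mem_compl_iff, T.mem_drawing_iff hn hP]
    constructor
    · intro h
      by_cases hx : x ∈ convexHull ℝ (P '' (o : Set ℕ))
      · obtain ⟨σ, hσ, hxσ⟩ := T.exists_mem_cell hx
        refine Or.inl ⟨σ, hσ, ?_, hxσ⟩
        by_contra h3
        exact h ⟨σ, hσ, by have := T.card_le σ hσ; omega, hxσ⟩
      · exact Or.inr hx
    · rintro (⟨σ, hσ, h3, hx⟩ | hx) ⟨τ, hτ, h2, hx'⟩
      · rw [T.eq_of_mem_cell hσ hτ hx hx'] at h3
        omega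
      · exact hx (T.mem_convexHull_of_mem_cell hτ hx')
  rcases (hnd z).1 hz with ⟨σ, hσ, h3, hzσ⟩ | hz'
  · refine Or.inl ⟨σ, hσ, h3, ?_⟩
    refine connectedComponentIn_eq_of_isOpen
      (V := (⋃ τ ∈ {τ | τ ∈ K ∧ τ.card = 3 ∧ τ ≠ σ}, cell P τ)
        ∪ (convexHull ℝ (P '' (o : Set ℕ)))ᶜ) (T.isOpen_cell hσ h3) ?_ ?_ ?_ ?_ hzσ
    · exact (isOpen_biUnion fun τ hτ => T.isOpen_cell hτ.1 hτ.2.1).union hcompact.isOpen_compl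
    · rw [Set.disjoint_left]
      rintro x hx (hx' | hx')
      · obtain ⟨τ, hτ, hxτ⟩ := Set.mem_iUnion₂.1 hx'
        exact hτ.2.2 (T.eq_of_mem_cell hτ.1 hσ hxτ hx)
      · exact hx' (T.mem_convexHull_of_mem_cell hσ hx)
    · ext x
      rw [hnd]
      constructor
      · rintro (⟨τ, hτ, h3', hx⟩ | hx)
        · by_cases h : τ = σ
          · exact Or.inl (h ▸ hx)
          · exact Or.inr (Or.inl (Set.mem_biUnion (show τ ∈ {τ | τ ∈ K ∧ τ.card = 3 ∧ τ ≠ σ} from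
              ⟨hτ, h3', h⟩) hx))
        · exact Or.inr (Or.inr hx)
      · rintro (hx | hx | hx)
        · exact Or.inl ⟨σ, hσ, h3, hx⟩
        · obtain ⟨τ, hτ, hxτ⟩ := Set.mem_iUnion₂.1 hx
          exact Or.inl ⟨τ, hτ.1, hτ.2.1, hxτ⟩
        · exact Or.inr hx
    · rw [T.cell_eq_interior hσ h3]
      exact (convex_convexHull ℝ _).interior.isPreconnected
  · refine Or.inr ?_
    refine connectedComponentIn_eq_of_isOpen
      (V := ⋃ τ ∈ {τ | τ ∈ K ∧ τ.card = 3}, cell P τ) hcompact.isOpen_compl ?_ ?_ ?_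
      (isPreconnected_compl_of_convex (convex_convexHull ℝ _) (isBounded_convexHull_image P o)) hz'
    · exact isOpen_biUnion fun τ hτ => T.isOpen_cell hτ.1 hτ.2
    · rw [Set.disjoint_left]
      intro x hx hx'
      obtain ⟨τ, hτ, hxτ⟩ := Set.mem_iUnion₂.1 hx'
      exact hx (T.mem_convexHull_of_mem_cell hτ.1 hxτ)
    · ext x
      rw [hnd, or_comm]
      refine or_congr Iff.rfl ?_
      simp [and_assoc]

theorem isTriangulation (T : Tiling P K o) (hn : ∀ i, {i} ∈ K ↔ i < n)
    (hP : Function.Injective fun i : Fin n => P i) :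
    (tilingGraph P K n hP).IsTriangulation := by
  refine ⟨T.isPlane hn hP, ?_, ?_⟩
  · intro F hF hb
    rcases T.face_cases hn hP hF with ⟨σ, hσ, h3, rfl⟩ | rfl
    · obtain ⟨a, b, c, hcyc, -, htri⟩ := T.exists_triangle hn hP h3
        fun τ hτ h2 => T.down _ hσ _ hτ (Finset.card_pos.1 (by omega))
      exact ⟨a, b, c, hcyc, by rw [htri, T.cell_eq_interior hσ h3]⟩
    · exact absurd hb fun h => NormedSpace.unbounded_univ ℝ ℂ
        (by simpa using (isBounded_convexHull_image P o).union h)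
  · intro F hF hb
    rcases T.face_cases hn hP hF with ⟨σ, hσ, h3, rfl⟩ | rfl
    · refine absurd ?_ hb
      rw [T.cell_eq_interior hσ h3]
      exact (isBounded_convexHull_image P σ).subset interior_subset
    · obtain ⟨a, b, c, hcyc, -, htri⟩ := T.exists_triangle hn hP T.outer_card T.outer_edges
      exact ⟨a, b, c, hcyc, by rw [htri]⟩

end Tiling

/-! ### Compass directions -/

namespace GeometricGraph

variable {V : Type} (G : GeometricGraph V)

theorem ccwAngle_nonneg (t v u : V) : 0 ≤ G.ccwAngle t v u :=
  (toIcoMod_mem_Ico Real.two_pi_pos 0 _).1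

theorem ccwAngle_lt (t v u : V) : G.ccwAngle t v u < 2 * Real.pi := by
  have h := (toIcoMod_mem_Ico Real.two_pi_pos 0
    (Complex.arg ((G.pos u - G.pos v) / (G.pos t - G.pos v)))).2
  rwa [zero_add] at h

/-- Polar coordinates about `v` in which the direction of `t` has angle zero. -/
theorem exists_polar {t v u : V} (ht : t ≠ v) (hu : u ≠ v) : ∃ r : ℝ, 0 < r ∧
    (G.pos u - G.pos v) / (G.pos t - G.pos v)
      = ⟨r * Real.cos (G.ccwAngle t v u), r * Real.sin (G.ccwAngle t v u)⟩ := by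
  have h1 : G.pos t - G.pos v ≠ 0 := sub_ne_zero.2 (G.pos_injective.ne ht)
  have h2 : G.pos u - G.pos v ≠ 0 := sub_ne_zero.2 (G.pos_injective.ne hu)
  obtain ⟨q, hq⟩ : ∃ q, q = (G.pos u - G.pos v) / (G.pos t - G.pos v) := ⟨_, rfl⟩
  have hq0 : q ≠ 0 := hq ▸ div_ne_zero h2 h1
  have hc : Real.cos (G.ccwAngle t v u) = Real.cos q.arg := by
    rw [ccwAngle, ← hq, toIcoMod, zsmul_eq_mul, Real.cos_sub_int_mul_two_pi]
  have hs : Real.sin (G.ccwAngle t v u) = Real.sin q.arg := by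
    rw [ccwAngle, ← hq, toIcoMod, zsmul_eq_mul, Real.sin_sub_int_mul_two_pi]
  refine ⟨‖q‖, norm_pos_iff.2 hq0, ?_⟩
  rw [← hq, hc, hs]
  exact Complex.ext (Complex.norm_mul_cos_arg q).symm (Complex.norm_mul_sin_arg q).symm

theorem ccwAngle_self_target {t v : V} (h : t ≠ v) : G.ccwAngle t v t = 0 := by
  have h1 : G.pos t - G.pos v ≠ 0 := sub_ne_zero.2 (G.pos_injective.ne h)
  rw [ccwAngle, div_self h1, Complex.arg_one, toIcoMod_apply_left]

/-- Two vertices seen from `v` at the same angle lie on one ray from `v`. -/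
theorem exists_smul_of_ccwAngle_eq {t v x y : V} (ht : t ≠ v) (hx : x ≠ v) (hy : y ≠ v)
    (h : G.ccwAngle t v x = G.ccwAngle t v y) :
    ∃ r : ℝ, 0 < r ∧ G.pos x - G.pos v = r • (G.pos y - G.pos v) := by
  have h1 : G.pos t - G.pos v ≠ 0 := sub_ne_zero.2 (G.pos_injective.ne ht)
  obtain ⟨r, hr, he⟩ := G.exists_polar ht hx
  obtain ⟨s, hs, hf⟩ := G.exists_polar ht hy
  refine ⟨r / s, by positivity, ?_⟩
  rw [div_eq_iff h1] at he hf
  rw [he, hf, h, Complex.real_smul, ← mul_assoc]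
  congr 1
  apply Complex.ext <;> simp <;> field_simp

/-- The direction of `t` lies strictly inside the angle `u v w` (which is less than `π`), with `u`
on the counterclockwise side. -/
def InSector (t v u w : V) : Prop :=
  0 < cross (G.pos t - G.pos v) (G.pos u - G.pos v) ∧ ∃ a b : ℝ, 0 < a ∧ 0 < b ∧
    G.pos t - G.pos v = a • (G.pos u - G.pos v) + b • (G.pos w - G.pos v)

variable {G}

/-- If the direction of `p` lies between those of `d` and `q`, then `p` lies in the cone spanned by
`d` and `q`; the angles `α` of `p` and `β` of `q` are measured from `d`. -/
theorem exists_cone_of_sin {d p q : ℂ} {r s α β : ℝ} (hd : d ≠ 0) (hr : 0 < r) (hs : 0 < s)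
    (hp : p / d = ⟨r * Real.cos α, r * Real.sin α⟩) (hq : q / d = ⟨s * Real.cos β, s * Real.sin β⟩)
    (hk : (0 < Real.sin β ∧ 0 < Real.sin (β - α) ∧ 0 ≤ Real.sin α) ∨
      (Real.sin β < 0 ∧ Real.sin (β - α) < 0 ∧ Real.sin α ≤ 0)) :
    ∃ a b : ℝ, 0 < a ∧ 0 ≤ b ∧ p = a • d + b • q := by
  have hβ : Real.sin β ≠ 0 := by rcases hk with h | h <;> [exact h.1.ne'; exact h.1.ne]
  refine ⟨r * (Real.sin (β - α) / Real.sin β), r / s * (Real.sin α / Real.sin β), ?_, ?_, ?_⟩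
  · rcases hk with h | h
    · exact mul_pos hr (div_pos h.2.1 h.1)
    · exact mul_pos hr (div_pos_of_neg_of_neg h.2.1 h.1)
  · rcases hk with h | h
    · exact mul_nonneg (by positivity) (div_nonneg h.2.2 h.1.le)
    · exact mul_nonneg (by positivity) (div_nonneg_of_nonpos h.2.2 h.1.le)
  · rw [div_eq_iff hd] at hp hq
    have e1 : r * Real.cos α = r * (Real.sin (β - α) / Real.sin β)
        + r / s * (Real.sin α / Real.sin β) * (s * Real.cos β) := by
      rw [Real.sin_sub]
      field_simp
      ring
    have e2 : r * Real.sin α = r / s * (Real.sin α / Real.sin β) * (s * Real.sin β) := by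
      field_simp
    rw [hp, hq, Complex.real_smul, Complex.real_smul, ← mul_assoc, ← add_mul]
    congr 1
    apply Complex.ext
    · simpa only [Complex.add_re, Complex.re_ofReal_mul, Complex.ofReal_re] using e1
    · simpa only [Complex.add_im, Complex.im_ofReal_mul, Complex.ofReal_im, zero_add] using e2

theorem InSector.ne {t v u w : V} (h : G.InSector t v u w) : t ≠ v ∧ u ≠ v := by
  constructor
  · rintro rfl
    simp [InSector, cross] at h
  · rintro rfl
    simp [InSector, cross] at h

/-- A complex quotient has an imaginary part of the sign of the cross product. -/
theorem im_div_eq_cross (p d : ℂ) : (p / d).im = cross d p / Complex.normSq d := by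
  rw [Complex.div_im, cross]
  ring

/-- A vertex whose angle is smaller than that of `u` lies in the cone spanned by `u` and `w`. -/
theorem InSector.exists_of_ccwAngle_lt {t v u w x : V} (h : G.InSector t v u w) (hx : x ≠ v)
    (hlt : G.ccwAngle t v x < G.ccwAngle t v u) : ∃ a b : ℝ, 0 < a ∧ 0 < b ∧
      G.pos x - G.pos v = a • (G.pos u - G.pos v) + b • (G.pos w - G.pos v) := by
  obtain ⟨ht, hu⟩ := h.ne
  have h1 : G.pos t - G.pos v ≠ 0 := sub_ne_zero.2 (G.pos_injective.ne ht)
  obtain ⟨hc, a, b, ha, hb, hab⟩ := h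
  obtain ⟨r, hr, he⟩ := G.exists_polar ht hx
  obtain ⟨s, hs, hf⟩ := G.exists_polar ht hu
  have him := im_div_eq_cross (G.pos u - G.pos v) (G.pos t - G.pos v)
  rw [hf] at him
  have hsu : 0 < Real.sin (G.ccwAngle t v u) := by
    have : 0 < s * Real.sin (G.ccwAngle t v u) := by
      rw [show s * Real.sin (G.ccwAngle t v u) = _ from him]
      exact div_pos hc (Complex.normSq_pos.2 h1)
    exact pos_of_mul_pos_right this hs.le
  have hx0 := G.ccwAngle_nonneg t v x
  have hupi : G.ccwAngle t v u < Real.pi := by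
    by_contra! hle
    have := Real.sin_nonpos_of_nonpos_of_neg_pi_le (x := G.ccwAngle t v u - 2 * Real.pi)
      (by linarith [G.ccwAngle_lt t v u]) (by linarith)
    rw [Real.sin_sub_two_pi] at this
    linarith
  obtain ⟨c, d, hc0, hd0, hcd⟩ := exists_cone_of_sin h1 hr hs he hf (Or.inl ⟨hsu,
    Real.sin_pos_of_pos_of_lt_pi (by linarith) (by linarith),
    Real.sin_nonneg_of_nonneg_of_le_pi hx0 (by linarith)⟩)
  refine ⟨c * a + d, c * b, by positivity, by positivity, ?_⟩
  rw [hcd, hab]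
  module

/-- A vertex whose angle is larger than that of `w` lies in the cone spanned by `u` and `w`. -/
theorem InSector.exists_of_lt_ccwAngle {t v u w x : V} (h : G.InSector t v u w) (hx : x ≠ v)
    (hw : w ≠ v) (hlt : G.ccwAngle t v w < G.ccwAngle t v x) : ∃ a b : ℝ, 0 < a ∧ 0 < b ∧
      G.pos x - G.pos v = a • (G.pos u - G.pos v) + b • (G.pos w - G.pos v) := by
  obtain ⟨ht, hu⟩ := h.ne
  have h1 : G.pos t - G.pos v ≠ 0 := sub_ne_zero.2 (G.pos_injective.ne ht)
  obtain ⟨hc, a, b, ha, hb, hab⟩ := h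
  have hcw : cross (G.pos t - G.pos v) (G.pos w - G.pos v) < 0 := by
    have e : a * cross (G.pos t - G.pos v) (G.pos u - G.pos v)
        + b * cross (G.pos t - G.pos v) (G.pos w - G.pos v) = 0 := by
      have hr := congrArg Complex.re hab
      have hi := congrArg Complex.im hab
      simp only [Complex.add_re, Complex.add_im, Complex.smul_re, Complex.smul_im,
        smul_eq_mul] at hr hi
      simp only [cross]
      linear_combination -(G.pos t - G.pos v).re * hi + (G.pos t - G.pos v).im * hr
    nlinarith [mul_pos ha hc]
  obtain ⟨r, hr, he⟩ := G.exists_polar ht hx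
  obtain ⟨s, hs, hf⟩ := G.exists_polar ht hw
  have him := im_div_eq_cross (G.pos w - G.pos v) (G.pos t - G.pos v)
  rw [hf] at him
  have hsw : Real.sin (G.ccwAngle t v w) < 0 := by
    have : s * Real.sin (G.ccwAngle t v w) < 0 := by
      rw [show s * Real.sin (G.ccwAngle t v w) = _ from him]
      exact div_neg_of_neg_of_pos hcw (Complex.normSq_pos.2 h1)
    exact neg_of_mul_neg_right this hs.le
  have hx2 := G.ccwAngle_lt t v x
  have hwpi : Real.pi < G.ccwAngle t v w := by
    by_contra! hle
    have := Real.sin_nonneg_of_nonneg_of_le_pi (G.ccwAngle_nonneg t v w) hle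
    linarith
  obtain ⟨c, d, hc0, hd0, hcd⟩ := exists_cone_of_sin h1 hr hs he hf (Or.inr ⟨hsw,
    Real.sin_neg_of_neg_of_neg_pi_lt (by linarith) (by linarith), by
      rw [← Real.sin_sub_two_pi]
      exact Real.sin_nonpos_of_nonpos_of_neg_pi_le (by linarith) (by linarith)⟩)
  refine ⟨c * a, c * b + d, by positivity, by positivity, ?_⟩
  rw [hcd, hab]
  module

theorem ccw_eq {t v u : V} (hu : G.graph.Adj v u)
    (h : ∀ w, G.graph.Adj v w → w ≠ u → G.ccwAngle t v u < G.ccwAngle t v w) :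
    G.ccw t v = u := by
  have hex : ∃ u, G.graph.Adj v u ∧ ∀ w, G.graph.Adj v w → G.ccwAngle t v u ≤ G.ccwAngle t v w :=
    ⟨u, hu, fun w hw => by
      by_cases hwu : w = u
      · rw [hwu]
      · exact (h w hw hwu).le⟩
  rw [ccw, dif_pos hex]
  by_contra hne
  exact (h _ hex.choose_spec.1 hne).not_ge (hex.choose_spec.2 u hu)

theorem cw_eq {t v u : V} (hu : G.graph.Adj v u)
    (h : ∀ w, G.graph.Adj v w → w ≠ u → G.ccwAngle t v w < G.ccwAngle t v u) :
    G.cw t v = u := by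
  have hex : ∃ u, G.graph.Adj v u ∧ ∀ w, G.graph.Adj v w → G.ccwAngle t v w ≤ G.ccwAngle t v u :=
    ⟨u, hu, fun w hw => by
      by_cases hwu : w = u
      · rw [hwu]
      · exact (h w hw hwu).le⟩
  rw [cw, dif_pos hex]
  by_contra hne
  exact (h _ hex.choose_spec.1 hne).not_ge (hex.choose_spec.2 u hu)

theorem cw_ne [Finite V] {t v u w : V} (hu : G.graph.Adj v u)
    (h : G.ccwAngle t v w < G.ccwAngle t v u) : G.cw t v ≠ w := by
  obtain ⟨m, hm, hmax⟩ := (Set.toFinite {x | G.graph.Adj v x}).exists_maximalFor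
    (G.ccwAngle t v) _ ⟨u, hu⟩
  have hex : ∃ u, G.graph.Adj v u ∧ ∀ w, G.graph.Adj v w → G.ccwAngle t v w ≤ G.ccwAngle t v u :=
    ⟨m, hm, fun w hw => by
      rcases le_total (G.ccwAngle t v w) (G.ccwAngle t v m) with h | h
      · exact h
      · exact hmax hw h⟩
  rw [cw, dif_pos hex]
  intro he
  have := hex.choose_spec.2 u hu
  rw [he] at this
  linarith

end GeometricGraph

namespace Tiling

variable {P : ℕ → ℂ} {K : Finset (Finset ℕ)} {o : Finset ℕ} {n : ℕ}

/-- Distinct neighbours of `v` are seen from `v` in distinct directions. -/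
theorem ccwAngle_injOn (T : Tiling P K o) (hn : ∀ i, {i} ∈ K ↔ i < n)
    (hP : Function.Injective fun i : Fin n => P i) {t v x y : Fin n} (ht : t ≠ v)
    (hx : (tilingGraph P K n hP).graph.Adj v x) (hy : (tilingGraph P K n hP).graph.Adj v y)
    (h : (tilingGraph P K n hP).ccwAngle t v x = (tilingGraph P K n hP).ccwAngle t v y) :
    x = y := by
  obtain ⟨r, hr, he⟩ := GeometricGraph.exists_smul_of_ccwAngle_eq _ ht hx.1.symm hy.1.symm h
  have he' : P x - P v = r • (P y - P v) := he
  have key : ∀ x y : Fin n, (tilingGraph P K n hP).graph.Adj v x →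
      (tilingGraph P K n hP).graph.Adj v y → ∀ r : ℝ, 0 < r → r < 1 →
      P x - P v = r • (P y - P v) → False := by
    intro x y hx hy r hr hr1 he
    have hm : P x ∈ cell P {(v : ℕ), (y : ℕ)} := by
      rw [cell_pair P fun h => hy.1 (Fin.ext h), mem_openSegment_iff_smul]
      exact ⟨r, ⟨hr, hr1⟩, by rw [← he]; ring⟩
    have := congrArg Finset.card
      (T.eq_of_mem_cell hy.2 ((hn x).2 x.2) hm (by rw [cell_singleton]; rfl))
    rw [Finset.card_pair fun h => hy.1 (Fin.ext h)] at this
    simp at this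
  rcases lt_trichotomy r 1 with h1 | h1 | h1
  · exact (key x y hx hy r hr h1 he').elim
  · rw [h1, one_smul] at he'
    exact hP (sub_left_injective he')
  · refine (key y x hy hx (1 / r) (by positivity) (by rwa [div_lt_one hr]) ?_).elim
    rw [he', smul_smul, one_div_mul_cancel hr.ne', one_smul]

/-- No edge leaves the vertex `v` of a triangle `v u w` of the tiling into that triangle. -/
theorem not_adj_of_cone (T : Tiling P K o) (hP : Function.Injective fun i : Fin n => P i)
    {v u w x : Fin n} (hvu : v ≠ u) (hvw : v ≠ w) (huw : u ≠ w)
    (hf : {(v : ℕ), (u : ℕ), (w : ℕ)} ∈ K) {a b : ℝ} (ha : 0 < a) (hb : 0 < b)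
    (h : P x - P v = a • (P u - P v) + b • (P w - P v)) :
    ¬ (tilingGraph P K n hP).graph.Adj v x := by
  intro hx
  have hvu' : (v : ℕ) ≠ u := fun h => hvu (Fin.ext h)
  have hvw' : (v : ℕ) ≠ w := fun h => hvw (Fin.ext h)
  have huw' : (u : ℕ) ≠ w := fun h => huw (Fin.ext h)
  have hvx' : (v : ℕ) ≠ x := fun h => hx.1 (Fin.ext h)
  have hs : 0 < a + b := by positivity
  -- A point of the edge so close to `v` that it has not left the triangle.
  have h1 : P v + (1 / (1 + a + b)) • (P x - P v) ∈ cell P {(v : ℕ), (x : ℕ)} := by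
    rw [cell_pair P hvx', mem_openSegment_iff_smul]
    exact ⟨1 / (1 + a + b), ⟨by positivity, by rw [div_lt_one (by positivity)]; linarith⟩, rfl⟩
  have h2 : P v + (1 / (1 + a + b)) • (P x - P v) ∈ cell P {(v : ℕ), (u : ℕ), (w : ℕ)} := by
    rw [cell_triple P hvu' hvw' huw']
    refine ⟨1 / (1 + a + b), a / (1 + a + b), b / (1 + a + b), by positivity, by positivity,
      by positivity, by field_simp, ?_⟩
    have e : (1 / (1 + a + b)) = 1 - a / (1 + a + b) - b / (1 + a + b) := by field_simp; ring
    have e1 : a / (1 + a + b) = 1 / (1 + a + b) * a := by ring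
    have e2 : b / (1 + a + b) = 1 / (1 + a + b) * b := by ring
    rw [h, smul_add, smul_smul, smul_smul, ← e1, ← e2, e]
    module
  have := congrArg Finset.card (T.eq_of_mem_cell hx.2 hf h1 h2)
  rw [Finset.card_pair hvx', Finset.card_eq_three.2 ⟨_, _, _, hvu', hvw', huw', rfl⟩] at this
  omega

/-- If the ray from `v` to `t` enters the triangle `v u w` of the tiling, with `u` on its
counterclockwise side, then the compass neighbours of `v` are `u` and `w`. -/
theorem compass_eq (T : Tiling P K o) (hn : ∀ i, {i} ∈ K ↔ i < n)
    (hP : Function.Injective fun i : Fin n => P i) {t v u w : Fin n}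
    (hvu : v ≠ u) (hvw : v ≠ w) (huw : u ≠ w) (hf : {(v : ℕ), (u : ℕ), (w : ℕ)} ∈ K)
    (hs : (tilingGraph P K n hP).InSector t v u w) :
    (tilingGraph P K n hP).ccw t v = u ∧ (tilingGraph P K n hP).cw t v = w := by
  have hu : (tilingGraph P K n hP).graph.Adj v u := ⟨hvu, T.down _ hf _ (by grind) (by simp)⟩
  have hw : (tilingGraph P K n hP).graph.Adj v w := ⟨hvw, T.down _ hf _ (by grind) (by simp)⟩
  constructor
  · apply GeometricGraph.ccw_eq hu
    intro x hx hxu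
    rcases lt_trichotomy ((tilingGraph P K n hP).ccwAngle t v u)
      ((tilingGraph P K n hP).ccwAngle t v x) with h | h | h
    · exact h
    · exact absurd (T.ccwAngle_injOn hn hP hs.ne.1 hu hx h).symm hxu
    · obtain ⟨a, b, ha, hb, hab⟩ := hs.exists_of_ccwAngle_lt hx.1.symm h
      exact absurd hx (T.not_adj_of_cone hP hvu hvw huw hf ha hb hab)
  · apply GeometricGraph.cw_eq hw
    intro x hx hxw
    rcases lt_trichotomy ((tilingGraph P K n hP).ccwAngle t v x)
      ((tilingGraph P K n hP).ccwAngle t v w) with h | h | h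
    · exact h
    · exact absurd (T.ccwAngle_injOn hn hP hs.ne.1 hx hw h) hxw
    · obtain ⟨a, b, ha, hb, hab⟩ := hs.exists_of_lt_ccwAngle hx.1.symm hvw.symm h
      exact absurd hx (T.not_adj_of_cone hP hvu hvw huw hf ha hb hab)

/-- A neighbour of `t` has `t` as its counterclockwise compass neighbour. -/
theorem ccw_eq_target (T : Tiling P K o) (hn : ∀ i, {i} ∈ K ↔ i < n)
    (hP : Function.Injective fun i : Fin n => P i) {t v : Fin n}
    (h : (tilingGraph P K n hP).graph.Adj v t) : (tilingGraph P K n hP).ccw t v = t := by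
  apply GeometricGraph.ccw_eq h
  intro x hx hxt
  refine lt_of_le_of_ne ?_ fun he => hxt (T.ccwAngle_injOn hn hP h.1.symm h hx he).symm
  rw [GeometricGraph.ccwAngle_self_target _ h.1.symm]
  exact GeometricGraph.ccwAngle_nonneg _ _ _ _

/-- A neighbour of `t` with a further neighbour does not have `t` as its clockwise compass
neighbour. -/
theorem cw_ne_target (T : Tiling P K o) (hn : ∀ i, {i} ∈ K ↔ i < n)
    (hP : Function.Injective fun i : Fin n => P i) {t v x : Fin n}
    (h : (tilingGraph P K n hP).graph.Adj v t) (hx : (tilingGraph P K n hP).graph.Adj v x)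
    (hxt : x ≠ t) : (tilingGraph P K n hP).cw t v ≠ t := by
  apply GeometricGraph.cw_ne hx
  refine lt_of_le_of_ne ?_ fun he => hxt (T.ccwAngle_injOn hn hP h.1.symm h hx he).symm
  rw [GeometricGraph.ccwAngle_self_target _ h.1.symm]
  exact GeometricGraph.ccwAngle_nonneg _ _ _ _

end Tiling

/-! ### Fair bits -/

instance isProbabilityMeasure_fairBits : IsProbabilityMeasure fairBits := by
  unfold fairBits; infer_instance

/-- A given block of `N` bits consists of `true`s only with probability `2⁻ᴺ`. -/
theorem fairBits_run (m N : ℕ) :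
    fairBits {ω | ∀ j < N, ω (m + j) = true} = (2⁻¹ : ℝ≥0∞) ^ N := by
  have h : {ω : ℕ → Bool | ∀ j < N, ω (m + j) = true}
      = Set.pi (Finset.Ico m (m + N) : Finset ℕ) fun _ => {true} := by
    ext ω
    simp only [Set.mem_ofPred_eq, Set.mem_pi, Finset.coe_Ico, Set.mem_Ico, Set.mem_singleton_iff]
    constructor
    · intro h i hi
      have := h (i - m) (by omega)
      rwa [Nat.add_sub_cancel' hi.1] at this
    · intro h j hj
      exact h _ ⟨by omega, by omega⟩
  rw [h, fairBits, Measure.infinitePi_pi _ fun i _ => MeasurableSet.singleton _]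
  simp

theorem measurableSet_run (m N : ℕ) :
    MeasurableSet {ω : ℕ → Bool | ∀ j < N, ω (m + j) = true} := by
  have : {ω : ℕ → Bool | ∀ j < N, ω (m + j) = true}
      = ⋂ j, ⋂ (_ : j < N), (fun ω : ℕ → Bool => ω (m + j)) ⁻¹' {true} := by
    ext; simp
  rw [this]
  exact MeasurableSet.iInter fun j => MeasurableSet.iInter fun _ =>
    measurable_pi_apply _ (MeasurableSet.singleton _)

/-- The event that none of the first `J` blocks of `N` bits consists of `true`s only. -/
def noFullBlock (N J : ℕ) : Set (ℕ → Bool) :=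
  {ω | ∀ k < J, ¬ ∀ j < N, ω (N * k + j) = true}

theorem measurableSet_noFullBlock (N J : ℕ) : MeasurableSet (noFullBlock N J) := by
  have : noFullBlock N J = ⋂ k, ⋂ (_ : k < J), {ω | ∀ j < N, ω (N * k + j) = true}ᶜ := by
    ext; simp [noFullBlock]
  rw [this]
  exact MeasurableSet.iInter fun k => MeasurableSet.iInter fun _ => (measurableSet_run _ _).compl

theorem noFullBlock_succ (N J : ℕ) :
    noFullBlock N (J + 1) = noFullBlock N J \ {ω | ∀ j < N, ω (N * J + j) = true} := by
  ext ω
  simp only [noFullBlock, Set.mem_ofPred_eq, Set.mem_sdiff]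
  constructor
  · exact fun h => ⟨fun k hk => h k (by omega), h J (by omega)⟩
  · rintro ⟨h1, h2⟩ k hk
    rcases Nat.lt_succ_iff_lt_or_eq.1 hk with h | rfl
    · exact h1 k h
    · exact h2

/-- Disjoint blocks are independent. -/
theorem fairBits_noFullBlock (N J : ℕ) :
    fairBits.real (noFullBlock N J) = (1 - (2⁻¹ : ℝ) ^ N) ^ J := by
  induction J with
  | zero => simp [noFullBlock]
  | succ J ih =>
    have hind : ProbabilityTheory.iIndepFun (fun i (ω : ℕ → Bool) => ω i) fairBits :=
      ProbabilityTheory.iIndepFun_infinitePi (X := fun _ b => b) fun _ => measurable_id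
    have hd : Disjoint (Finset.range (N * J)) (Finset.Ico (N * J) (N * J + N)) := by
      rw [Finset.disjoint_left]
      intro i hi hi'
      rw [Finset.mem_range] at hi
      rw [Finset.mem_Ico] at hi'
      omega
    have h2 := hind.indepFun_finset _ _ hd fun i => measurable_pi_apply i
    have e1 : noFullBlock N J = (fun (ω : ℕ → Bool) (i : Finset.range (N * J)) => ω i) ⁻¹'
        {x | ∀ k < J, ¬ ∀ j < N, ∀ h : N * k + j < N * J, x ⟨N * k + j, Finset.mem_range.2 h⟩
          = true} := by
      ext ω
      simp only [noFullBlock, Set.mem_ofPred_eq, Set.mem_preimage]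
      refine forall₂_congr fun k hk => not_congr <| forall₂_congr fun j hj => ?_
      have : N * k + j < N * J := by
        calc N * k + j < N * k + N := by omega
          _ = N * (k + 1) := by ring
          _ ≤ N * J := Nat.mul_le_mul_left _ hk
      simp [this]
    have e2 : {ω : ℕ → Bool | ∀ j < N, ω (N * J + j) = true}
        = (fun (ω : ℕ → Bool) (i : Finset.Ico (N * J) (N * J + N)) => ω i) ⁻¹'
        {x | ∀ i, x i = true} := by
      ext ω
      simp only [Set.mem_ofPred_eq, Set.mem_preimage, Subtype.forall, Finset.mem_Ico]
      constructor
      · intro h i hi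
        have := h (i - N * J) (by omega)
        rwa [Nat.add_sub_cancel' hi.1] at this
      · intro h j hj
        exact h _ ⟨by omega, by omega⟩
    have h3 := h2.measure_inter_preimage_eq_mul
      {x | ∀ k < J, ¬ ∀ j < N, ∀ h : N * k + j < N * J, x ⟨N * k + j, Finset.mem_range.2 h⟩ = true}
      {x | ∀ i, x i = true} (Set.toFinite _).measurableSet (Set.toFinite _).measurableSet
    rw [← e1, ← e2, fairBits_run] at h3
    have h4 := measureReal_inter_add_sdiff (μ := fairBits) (s := noFullBlock N J)
      (measurableSet_run (N * J) N)
    rw [← noFullBlock_succ, Measure.real, h3, ENNReal.toReal_mul, ← Measure.real, ih] at h4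
    simp only [ENNReal.toReal_pow, ENNReal.toReal_inv, ENNReal.toReal_ofNat] at h4
    rw [pow_succ]
    linarith

/-- The event that a run of `K` `true`s starts among the first `m` bits. -/
def hasRun (K m : ℕ) : Set (ℕ → Bool) := {ω | ∃ i < m, ∀ j < K, ω (i + j) = true}

theorem hasRun_eq (K m : ℕ) :
    hasRun K m = ⋃ i ∈ Finset.range m, {ω | ∀ j < K, ω (i + j) = true} := by
  ext; simp [hasRun]

theorem measurableSet_hasRun (K m : ℕ) : MeasurableSet (hasRun K m) := by
  rw [hasRun_eq]
  exact Finset.measurableSet_biUnion _ fun i _ => measurableSet_run i K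

theorem fairBits_hasRun_le (K m : ℕ) : fairBits (hasRun K m) ≤ m * (2⁻¹ : ℝ≥0∞) ^ K := by
  rw [hasRun_eq]
  refine (measure_biUnion_finset_le _ _).trans ?_
  simp [fairBits_run]

/-! ### Expected number of steps -/

namespace GeometricGraph

variable {V : Type} (G : GeometricGraph V) {s t : V}

theorem route_succ_of_ne {ω : ℕ → Bool} {m : ℕ} (h : G.route s t ω m ≠ t) :
    G.route s t ω (m + 1)
      = if ω m then G.ccw t (G.route s t ω m) else G.cw t (G.route s t ω m) := by
  rw [route, randomCompassStep, if_neg h]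

theorem route_succ_of_eq {ω : ℕ → Bool} {m : ℕ} (h : G.route s t ω m = t) :
    G.route s t ω (m + 1) = t := by
  rw [route, randomCompassStep, if_pos h]

/-- If every counterclockwise step decreases `ρ`, then `t` is reached by a long run of `true`s. -/
theorem route_eq_target {ρ : V → ℕ} (hρ : ∀ v, v ≠ t → ρ (G.ccw t v) < ρ v) {ω : ℕ → Bool}
    {N m : ℕ} (hN : ρ (G.route s t ω m) ≤ N) (hω : ∀ j < N, ω (m + j) = true) :
    G.route s t ω (m + N) = t := by
  have key : ∀ j ≤ N, G.route s t ω (m + j) = t ∨ ρ (G.route s t ω (m + j)) + j ≤ N := by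
    intro j
    induction j with
    | zero => exact fun _ => Or.inr hN
    | succ j ih =>
      intro hj
      by_cases h : G.route s t ω (m + j) = t
      · exact Or.inl (G.route_succ_of_eq h)
      · refine Or.inr ?_
        have h1 := (ih (by omega)).resolve_left h
        have h2 := hρ _ h
        rw [show m + (j + 1) = m + j + 1 from rfl, G.route_succ_of_ne h, hω j (by omega), if_pos rfl]
        omega
  rcases key N le_rfl with h | h
  · exact h
  · by_contra hne
    have := hρ _ hne
    omega

theorem expectedSteps_lt_top {ρ : V → ℕ} (hρ : ∀ v, v ≠ t → ρ (G.ccw t v) < ρ v) {N : ℕ}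
    (hN : ∀ v, ρ v ≤ N) (hN0 : N ≠ 0) : G.expectedSteps s t < ⊤ := by
  have hle : ∀ ω, G.numSteps s t ω
      ≤ ∑' J, (N : ℝ≥0∞) * (noFullBlock N J).indicator 1 ω := by
    intro ω
    rw [ENNReal.tsum_mul_left]
    by_cases h : ∃ k, ∀ j < N, ω (N * k + j) = true
    · classical
      obtain ⟨k, hk, hmin⟩ : ∃ k, (∀ j < N, ω (N * k + j) = true) ∧
          ∀ l < k, ¬ ∀ j < N, ω (N * l + j) = true :=
        ⟨Nat.find h, Nat.find_spec h, fun l hl => Nat.find_min h hl⟩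
      have h1 : G.numSteps s t ω ≤ ((N * k + N : ℕ) : ℝ≥0∞) :=
        iInf₂_le (N * k + N) (G.route_eq_target hρ (hN _) hk)
      refine h1.trans ?_
      have h2 : ∑ J ∈ Finset.range (k + 1), (noFullBlock N J).indicator (1 : (ℕ → Bool) → ℝ≥0∞) ω
          = (k + 1 : ℕ) := by
        rw [Finset.sum_congr rfl fun J hJ => Set.indicator_of_mem (show ω ∈ noFullBlock N J from
          fun l hl => hmin l (by have := Finset.mem_range.1 hJ; omega)) 1]
        simp
      calc ((N * k + N : ℕ) : ℝ≥0∞) = N * (k + 1 : ℕ) := by push_cast; ring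
        _ ≤ _ := by
          rw [← h2]
          gcongr
          exact ENNReal.sum_le_tsum _
    · push Not at h
      have h2 : ∀ J, (noFullBlock N J).indicator (1 : (ℕ → Bool) → ℝ≥0∞) ω = 1 := fun J =>
        Set.indicator_of_mem (show ω ∈ noFullBlock N J from fun k _ hk => by
          obtain ⟨j, hj, hj'⟩ := h k
          exact hj' (hk j hj)) 1
      simp only [h2]
      rw [ENNReal.tsum_const_eq_top_of_ne_zero one_ne_zero, ENNReal.mul_top (by simpa using hN0)]
      exact le_top
  have hp : ∀ J, fairBits (noFullBlock N J) = ENNReal.ofReal (1 - (2⁻¹ : ℝ) ^ N) ^ J := by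
    intro J
    rw [← ENNReal.ofReal_pow, ← fairBits_noFullBlock, ofReal_measureReal]
    rw [sub_nonneg]
    exact pow_le_one₀ (by norm_num) (by norm_num)
  calc G.expectedSteps s t
      ≤ ∫⁻ ω, ∑' J, (N : ℝ≥0∞) * (noFullBlock N J).indicator 1 ω ∂fairBits := lintegral_mono hle
    _ = ∑' J, (N : ℝ≥0∞) * ENNReal.ofReal (1 - (2⁻¹ : ℝ) ^ N) ^ J := by
      rw [lintegral_tsum fun J => ((measurable_one.indicator
        (measurableSet_noFullBlock N J)).const_mul _).aemeasurable]
      congr 1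
      ext J
      rw [lintegral_const_mul _ (measurable_one.indicator (measurableSet_noFullBlock N J)),
        lintegral_indicator_one (measurableSet_noFullBlock N J), hp]
    _ < ⊤ := by
      rw [ENNReal.tsum_mul_left, ENNReal.tsum_geometric]
      refine ENNReal.mul_lt_top (by simp) ?_
      rw [ENNReal.inv_lt_top, tsub_pos_iff_lt, ENNReal.ofReal_lt_one]
      have : (0 : ℝ) < 2⁻¹ ^ N := by positivity
      linarith

/-- Suppose that, away from the zeros of `l`, a counterclockwise step decreases `l` by at most one
and a clockwise step resets it to at least `K`. Then `t` is not reached before a run of `K`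
`true`s. -/
theorem route_ne_target {l : V → ℕ} {K : ℕ} (hs : K ≤ l s) (ht : l t = 0)
    (hcw : ∀ v, 0 < l v → K ≤ l (G.cw t v)) (hccw : ∀ v, 0 < l v → l v ≤ l (G.ccw t v) + 1)
    (hK : 0 < K) {ω : ℕ → Bool} {m : ℕ} (hω : ω ∉ hasRun K m) {i : ℕ} (hi : i ≤ m) :
    G.route s t ω i ≠ t := by
  have key : ∀ i ≤ m, 0 < l (G.route s t ω i) ∧
      ∃ r ≤ i, (∀ j < r, ω (i - r + j) = true) ∧ K ≤ l (G.route s t ω i) + r := by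
    intro i
    induction i with
    | zero => exact fun _ => ⟨lt_of_lt_of_le hK hs, 0, le_rfl, by simp, hs⟩
    | succ i ih =>
      intro hi
      obtain ⟨hpos, r, hri, hr, hKr⟩ := ih (by omega)
      have hne : G.route s t ω i ≠ t := by
        intro h
        rw [h, ht] at hpos
        exact lt_irrefl _ hpos
      rw [G.route_succ_of_ne hne]
      by_cases hb : ω i = true
      · rw [if_pos hb]
        have h1 := hccw _ hpos
        have hr' : ∀ j < r + 1, ω (i + 1 - (r + 1) + j) = true := by
          intro j hj
          rw [Nat.add_sub_add_right]
          rcases Nat.lt_succ_iff_lt_or_eq.1 hj with h | rfl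
          · exact hr j h
          · rwa [Nat.sub_add_cancel hri]
        have h2 : K ≤ l (G.ccw t (G.route s t ω i)) + (r + 1) := by omega
        refine ⟨?_, r + 1, by omega, hr', h2⟩
        by_contra h0
        exact hω ⟨i + 1 - (r + 1), by omega, fun j hj => hr' j (by omega)⟩
      · rw [if_neg hb]
        have h1 := hcw _ hpos
        exact ⟨by omega, 0, by omega, by simp, by omega⟩
  intro h
  have := (key i hi).1
  rw [h, ht] at this
  exact lt_irrefl _ this

theorem le_expectedSteps {l : V → ℕ} {K : ℕ} (hs : K ≤ l s) (ht : l t = 0)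
    (hcw : ∀ v, 0 < l v → K ≤ l (G.cw t v)) (hccw : ∀ v, 0 < l v → l v ≤ l (G.ccw t v) + 1)
    (hK : 0 < K) : ENNReal.ofReal (1 + 2 ^ K / 4) ≤ G.expectedSteps s t := by
  obtain ⟨k, rfl⟩ : ∃ k, K = k + 1 := ⟨K - 1, by omega⟩
  -- With `2 ^ (K - 1)` possible starts, a run of length `K` has probability at most one half.
  have hhalf : (2⁻¹ : ℝ≥0∞) ≤ fairBits (hasRun (k + 1) (2 ^ k))ᶜ := by
    rw [prob_compl_eq_one_sub (measurableSet_hasRun _ _)]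
    have h1 := fairBits_hasRun_le (k + 1) (2 ^ k)
    have h2 : ((2 ^ k : ℕ) : ℝ≥0∞) * 2⁻¹ ^ (k + 1) = 2⁻¹ := by
      push_cast
      rw [pow_succ, ← mul_assoc, ← mul_pow, ENNReal.mul_inv_cancel (by simp) (by simp)]
      simp
    rw [h2] at h1
    calc (2⁻¹ : ℝ≥0∞) = 1 - 2⁻¹ := ENNReal.one_sub_inv_two.symm
      _ ≤ _ := tsub_le_tsub_left h1 1
  have hle : ∀ ω, 1 + (2 ^ k : ℕ) * (hasRun (k + 1) (2 ^ k))ᶜ.indicator 1 ω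
      ≤ G.numSteps s t ω := by
    intro ω
    refine le_iInf₂ fun m hm => ?_
    by_cases hω : ω ∈ hasRun (k + 1) (2 ^ k)
    · rw [Set.indicator_of_notMem (by simpa using hω), mul_zero, add_zero]
      have : m ≠ 0 := by
        rintro rfl
        refine G.route_ne_target hs ht hcw hccw hK (m := 0) (ω := ω) ?_ le_rfl hm
        simp [hasRun]
      exact_mod_cast Nat.one_le_iff_ne_zero.2 this
    · rw [Set.indicator_of_mem (by simpa using hω)]
      have : 2 ^ k < m := by
        by_contra! h
        exact G.route_ne_target hs ht hcw hccw hK hω h hm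
      rw [Pi.one_apply, mul_one]
      exact_mod_cast (by omega : 1 + 2 ^ k ≤ m)
  calc ENNReal.ofReal (1 + 2 ^ (k + 1) / 4) = 1 + (2 ^ k : ℕ) * 2⁻¹ := by
        rw [ENNReal.ofReal_add (by norm_num) (by positivity), ENNReal.ofReal_one]
        congr 1
        rw [show (2 : ℝ) ^ (k + 1) / 4 = ((2 ^ k : ℕ) : ℝ) * 2⁻¹ by push_cast; ring,
          ENNReal.ofReal_mul (by positivity), ENNReal.ofReal_natCast,
          ENNReal.ofReal_inv_of_pos (by norm_num)]
        simp
    _ ≤ 1 + (2 ^ k : ℕ) * fairBits (hasRun (k + 1) (2 ^ k))ᶜ := by gcongr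
    _ = ∫⁻ ω, 1 + (2 ^ k : ℕ) * (hasRun (k + 1) (2 ^ k))ᶜ.indicator 1 ω ∂fairBits := by
      have hm : Measurable ((hasRun (k + 1) (2 ^ k))ᶜ.indicator (1 : (ℕ → Bool) → ℝ≥0∞)) :=
        measurable_one.indicator (measurableSet_hasRun (k + 1) (2 ^ k)).compl
      rw [lintegral_add_left measurable_const, lintegral_const_mul _ hm,
        lintegral_indicator_one (measurableSet_hasRun _ _).compl]
      simp
    _ ≤ G.expectedSteps s t := lintegral_mono hle

end GeometricGraph

/-! ### Building tilings -/

theorem card_triple {a b c : ℕ} (hab : a ≠ b) (hac : a ≠ c) (hbc : b ≠ c) :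
    ({a, b, c} : Finset ℕ).card = 3 :=
  Finset.card_eq_three.2 ⟨a, b, c, hab, hac, hbc, rfl⟩

/-- A triangle with its sides and corners. -/
theorem Tiling.triangle {P : ℕ → ℂ} {a b c : ℕ} (hab : a ≠ b) (hac : a ≠ c) (hbc : b ≠ c)
    (h : orient (P a) (P b) (P c) ≠ 0) :
    Tiling P (({a, b, c} : Finset ℕ).powerset.erase ∅) {a, b, c} where
  nonempty σ hσ := Finset.nonempty_iff_ne_empty.2 (Finset.mem_erase.1 hσ).1
  card_le σ hσ := by
    rw [← card_triple hab hac hbc]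
    exact Finset.card_le_card (Finset.mem_powerset.1 (Finset.mem_erase.1 hσ).2)
  down σ hσ τ hτ hne := Finset.mem_erase.2 ⟨hne.ne_empty, Finset.mem_powerset.2
    (hτ.trans (Finset.mem_powerset.1 (Finset.mem_erase.1 hσ).2))⟩
  outer_card := card_triple hab hac hbc
  outer_edges τ hτ h2 := Finset.mem_erase.2 ⟨by rintro rfl; simp at h2, Finset.mem_powerset.2 hτ⟩
  partitions := by
    intro z
    have h1 := Finset.add_sum_erase ({a, b, c} : Finset ℕ).powerset (fun σ => ind (cell P σ) z)
      (Finset.empty_mem_powerset _)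
    have h2 := Finset.add_sum_erase ({a, b, c} : Finset ℕ).powerset (fun σ => ind (cell P σ) z)
      (Finset.mem_powerset_self _)
    change _ + ∑ σ ∈ ({a, b, c} : Finset ℕ).ssubsets, _ = _ at h2
    rw [ssubsets_triple hab hac hbc, List.sum_toFinset _ (subsets_triple_nodup hab hac hbc)] at h2
    simp only [List.map_cons, List.map_nil, List.sum_cons, List.sum_nil, cell_triple P hab hac hbc,
      cell_pair P hab, cell_pair P hac, cell_pair P hbc, cell_singleton] at h1 h2
    have h3 := ind_compl_convexHull_triple h z
    have h4 : convexHull ℝ (P '' (({a, b, c} : Finset ℕ) : Set ℕ))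
        = convexHull ℝ {P a, P b, P c} := by simp [Set.image_insert_eq]
    rw [h4]
    omega

/-- The family obtained from `K` by exchanging the diagonal `a b` of a quadrilateral for `c d`. -/
def flipDiagonal (K : Finset (Finset ℕ)) (a b c d : ℕ) : Finset (Finset ℕ) :=
  (K \ {{a, b}, {a, b, c}, {a, b, d}}) ∪ {{c, d}, {c, d, a}, {c, d, b}}

theorem sum_insert_two {a b c d : ℕ} (hab : a ≠ b) (hac : a ≠ c) (had : a ≠ d) (hbc : b ≠ c)
    (hbd : b ≠ d) (hcd : c ≠ d) (g : Finset ℕ → ℕ) :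
    ∑ σ ∈ {{a, b}, {a, b, c}, {a, b, d}}, g σ = g {a, b} + g {a, b, c} + g {a, b, d} := by
  have h1 : ∀ x, a ≠ x → b ≠ x → ({a, b} : Finset ℕ) ≠ {a, b, x} := by
    intro x hax hbx h
    have := congrArg Finset.card h
    rw [Finset.card_pair hab, card_triple hab hax hbx] at this
    omega
  have h2 : ({a, b, c} : Finset ℕ) ≠ {a, b, d} := by
    intro h
    have : c ∈ ({a, b, d} : Finset ℕ) := h ▸ (by simp)
    grind
  rw [Finset.sum_insert (by simp [h1 c hac hbc, h1 d had hbd]), Finset.sum_pair h2, add_assoc]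

theorem Partitions.flipDiagonal {P : ℕ → ℂ} {K : Finset (Finset ℕ)} {o : Finset ℕ} (T : Partitions P K o)
    {a b c d : ℕ} (hab : a ≠ b) (hac : a ≠ c) (had : a ≠ d) (hbc : b ≠ c) (hbd : b ≠ d)
    (hcd : c ≠ d) (hK : {{a, b}, {a, b, c}, {a, b, d}} ⊆ K)
    (hK' : Disjoint K {{c, d}, {c, d, a}, {c, d, b}})
    (h1 : orient (P a) (P b) (P c) ≠ 0) (h2 : orient (P a) (P b) (P d) ≠ 0)
    (h3 : orient (P c) (P d) (P a) ≠ 0) (h4 : orient (P c) (P d) (P b) ≠ 0) {m : ℂ}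
    (hm : m ∈ openSegment ℝ (P a) (P b)) (hm' : m ∈ openSegment ℝ (P c) (P d)) :
    Partitions P (flipDiagonal K a b c d) o := by
  intro z
  have e1 := T z
  have e2 := ind_flip h1 h2 h3 h4 hm hm' z
  have e3 := Finset.sum_sdiff (f := fun σ => ind (cell P σ) z) hK
  have e4 := Finset.sum_union (f := fun σ => ind (cell P σ) z)
    (Finset.disjoint_of_subset_left (Finset.sdiff_subset
      (s := K) (t := {{a, b}, {a, b, c}, {a, b, d}})) hK')
  rw [sum_insert_two hab hac had hbc hbd hcd] at e3
  rw [sum_insert_two hcd hac.symm hbc.symm had.symm hbd.symm hab] at e4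
  rw [cell_triple P hab hac hbc, cell_triple P hab had hbd, cell_pair P hab] at e3
  rw [cell_triple P hcd hac.symm had.symm, cell_triple P hcd hbc.symm hbd.symm,
    cell_pair P hcd] at e4
  change ∑ σ ∈ (K \ {{a, b}, {a, b, c}, {a, b, d}}) ∪ {{c, d}, {c, d, a}, {c, d, b}}, _ + _ = 1
  omega

theorem singleton_mem_stellar {K : Finset (Finset ℕ)} {f : Finset ℕ} {v i : ℕ} (hf : f.card = 3) :
    {i} ∈ stellar K f v ↔ {i} ∈ K ∨ i = v := by
  rw [mem_stellar]
  constructor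
  · rintro (h | ⟨τ, -, h⟩)
    · exact Or.inl h.2
    · right
      have : v ∈ ({i} : Finset ℕ) := h ▸ Finset.mem_insert_self _ _
      exact (Finset.mem_singleton.1 this).symm
  · rintro (h | rfl)
    · refine Or.inl ⟨?_, h⟩
      rintro rfl
      simp at hf
    · refine Or.inr ⟨∅, ?_, rfl⟩
      rw [Finset.empty_ssubset]
      exact Finset.card_pos.1 (by omega)

theorem mem_stellar_of_notMem {K : Finset (Finset ℕ)} {f σ : Finset ℕ} {v i : ℕ} (hσ : σ ∈ K)
    (hi : i ∈ f) (hi' : i ∉ σ) : σ ∈ stellar K f v :=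
  mem_stellar.2 (Or.inl ⟨fun h => hi' (h ▸ hi), hσ⟩)

theorem mem_stellar_of_card {K : Finset (Finset ℕ)} {f σ : Finset ℕ} {v : ℕ} (hσ : σ ∈ K)
    (hf : f.card = 3) (h2 : σ.card ≤ 2) : σ ∈ stellar K f v :=
  mem_stellar.2 (Or.inl ⟨fun h => by rw [h] at h2; omega, hσ⟩)

theorem insert_mem_stellar {K : Finset (Finset ℕ)} {f τ : Finset ℕ} {v i : ℕ} (hτ : τ ⊆ f)
    (hi : i ∈ f) (hi' : i ∉ τ) : insert v τ ∈ stellar K f v :=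
  mem_stellar.2 (Or.inr ⟨τ, (Finset.ssubset_iff_of_subset hτ).2 ⟨i, hi, hi'⟩, rfl⟩)

/-! ### Triangulations with a universal vertex -/

/-- The corners `0`, `1`, `I` of a triangle, followed by points obtained by repeatedly taking the
centroid of `0`, `1` and the previous point. -/
noncomputable def fanPoint : ℕ → ℂ
  | 0 => 0
  | 1 => 1
  | 2 => Complex.I
  | i + 3 => (1 / 3 : ℝ) • fanPoint 0 + (1 / 3 : ℝ) • fanPoint 1 + (1 / 3 : ℝ) • fanPoint (i + 2)

/-- The tiling obtained from the triangle `0 1 2` by inserting `m` vertices, each of them into the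
triangle formed by `0`, `1` and the previous vertex. -/
def fanTiling : ℕ → Finset (Finset ℕ)
  | 0 => ({0, 1, 2} : Finset ℕ).powerset.erase ∅
  | m + 1 => stellar (fanTiling m) {0, 1, m + 2} (m + 3)

theorem fanTiling_spec (m : ℕ) : Tiling fanPoint (fanTiling m) {0, 1, 2} ∧
    (∀ i, {i} ∈ fanTiling m ↔ i < m + 3) ∧ {0, 1, m + 2} ∈ fanTiling m ∧
    (∀ i, 1 ≤ i → i < m + 3 → {0, i} ∈ fanTiling m) ∧
    ∀ i, 2 ≤ i → i < m + 3 → {1, i} ∈ fanTiling m := by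
  induction m with
  | zero =>
    refine ⟨Tiling.triangle (by simp) (by simp) (by simp) ?_, ?_, ?_, ?_, ?_⟩
    · simp [orient, cross, fanPoint]
    · intro i
      simp [fanTiling]
      omega
    · simp [fanTiling]
    · intro i h1 h2
      obtain rfl | rfl : i = 1 ∨ i = 2 := by omega
      · decide
      · decide
    · intro i h1 h2
      obtain rfl : i = 2 := by omega
      decide
  | succ m ih =>
    obtain ⟨T, hn, hf, h0, h1⟩ := ih
    have hc : ({0, 1, m + 2} : Finset ℕ).card = 3 :=
      card_triple (by simp) (by simp) (by omega)
    have hv : ∀ σ ∈ fanTiling m, m + 3 ∉ σ := fun σ hσ h =>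
      absurd (T.lt_of_mem hn hσ h) (lt_irrefl _)
    refine ⟨T.insert_vertex (by simp) (by simp) (by omega) hf hv ?_, ?_, ?_, ?_, ?_⟩
    · exact ⟨1 / 3, 1 / 3, 1 / 3, by norm_num, by norm_num, by norm_num, by norm_num,
        by conv_rhs => rw [fanPoint]⟩
    · intro i
      rw [fanTiling, singleton_mem_stellar hc, hn]
      omega
    · have : ({0, 1, m + 3} : Finset ℕ) = insert (m + 3) {0, 1} := by grind
      change ({0, 1, m + 3} : Finset ℕ) ∈ stellar _ _ _
      rw [this]
      exact insert_mem_stellar (i := m + 2) (by grind) (by simp) (by simp)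
    · intro i hi hi'
      rcases Nat.lt_or_ge i (m + 3) with h | h
      · exact mem_stellar_of_card (h0 i hi h) hc Finset.card_le_two
      · obtain rfl : i = m + 3 := by omega
        rw [Finset.pair_comm]
        exact insert_mem_stellar (i := 1) (by simp) (by simp) (by simp)
    · intro i hi hi'
      rcases Nat.lt_or_ge i (m + 3) with h | h
      · exact mem_stellar_of_card (h1 i hi h) hc Finset.card_le_two
      · obtain rfl : i = m + 3 := by omega
        rw [Finset.pair_comm]
        exact insert_mem_stellar (i := 0) (by simp) (by simp) (by simp)

/-- When every vertex is adjacent to the target, a step succeeds exactly if its bit is `true`. -/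
theorem exists_triangulation_fan (n : ℕ) (hn3 : 3 ≤ n) :
    ∃ (G : GeometricGraph (Fin n)) (s t : Fin n), G.IsTriangulation ∧
      G.expectedSteps s t < ⊤ ∧ ENNReal.ofReal (1 + 2 ^ 1 / 4) ≤ G.expectedSteps s t := by
  obtain ⟨m, rfl⟩ : ∃ m, n = m + 3 := ⟨n - 3, by omega⟩
  obtain ⟨T, hn, -, h0, h1⟩ := fanTiling_spec m
  have hP := T.injective hn
  obtain ⟨t, ht⟩ : ∃ t : Fin (m + 3), (t : ℕ) = 0 := ⟨0, rfl⟩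
  obtain ⟨s, hs⟩ : ∃ s : Fin (m + 3), (s : ℕ) = 1 := ⟨1, rfl⟩
  obtain ⟨u, hu⟩ : ∃ u : Fin (m + 3), (u : ℕ) = 2 := ⟨⟨2, by omega⟩, rfl⟩
  have hadj : ∀ v, v ≠ t → (tilingGraph fanPoint (fanTiling m) (m + 3) hP).graph.Adj v t := by
    intro v hv
    refine ⟨hv, ?_⟩
    rw [ht, Finset.pair_comm]
    refine h0 v ?_ v.2
    have : (v : ℕ) ≠ t := fun h => hv (Fin.ext h)
    omega
  have hccw : ∀ v, v ≠ t → (tilingGraph fanPoint (fanTiling m) (m + 3) hP).ccw t v = t :=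
    fun v hv => T.ccw_eq_target hn hP (hadj v hv)
  have hcw : ∀ v, v ≠ t → (tilingGraph fanPoint (fanTiling m) (m + 3) hP).cw t v ≠ t := by
    intro v hv
    have hvt : (v : ℕ) ≠ t := fun h => hv (Fin.ext h)
    by_cases hvs : v = s
    · refine T.cw_ne_target hn hP (hadj v hv) (x := u) ⟨?_, ?_⟩ ?_
      · intro h; rw [hvs, Fin.ext_iff] at h; omega
      · rw [hvs, hs]
        exact h1 u (by omega) u.2
      · intro h; rw [Fin.ext_iff] at h; omega
    · have hvs' : (v : ℕ) ≠ s := fun h => hvs (Fin.ext h)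
      refine T.cw_ne_target hn hP (hadj v hv) (x := s) ⟨hvs, ?_⟩ ?_
      · rw [hs, Finset.pair_comm]
        exact h1 v (by omega) v.2
      · intro h; rw [Fin.ext_iff] at h; omega
  have hst : s ≠ t := by intro h; rw [Fin.ext_iff] at h; omega
  refine ⟨tilingGraph fanPoint (fanTiling m) (m + 3) hP, s, t, T.isTriangulation hn hP, ?_, ?_⟩
  · refine GeometricGraph.expectedSteps_lt_top _ (ρ := fun v => if v = t then 0 else 1) (N := 1)
      ?_ ?_ one_ne_zero
    · intro v hv
      simp [hccw v hv, hv]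
    · intro v
      split_ifs <;> simp
  · refine GeometricGraph.le_expectedSteps _ (l := fun v => if v = t then 0 else 1) (K := 1)
      ?_ ?_ ?_ ?_ one_pos
    · simp [hst]
    · simp
    · intro v hv
      have hv' : v ≠ t := by rintro rfl; simp at hv
      simp [hcw v hv']
    · intro v hv
      split_ifs <;> simp

/-! ### The spiral triangulation -/

/-- The corners of the inner triangle. -/
def innerPoint : ℕ → ℂ
  | 0 => ⟨2, -1⟩
  | 1 => ⟨1, 3⟩
  | _ => ⟨-3, -2⟩

/-- The corners of the outer triangle. -/
def outerPoint : ℕ → ℂ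
  | 0 => ⟨10, 0⟩
  | 1 => ⟨0, 10⟩
  | _ => ⟨-10, -10⟩

/-- The limit of the `r`-th chain, a point of the edge between an inner and an outer corner that is
so close to the inner one that the target lies to the right of the chain. -/
noncomputable def limitPoint (r : ℕ) : ℂ :=
  (1 / 12 : ℝ) • outerPoint ((r + 1) % 3) + (11 / 12 : ℝ) • innerPoint r

/-- The target `0`, the inner corners `1`, `2`, `3`, the outer corners `4`, `5`, `6`, and three
chains: from the vertex `i ≥ 4` the chain continues with the vertex `i + 3`, half way to the limit
point of the chain. -/
noncomputable def spiralPoint (i : ℕ) : ℂ :=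
  if i = 0 then 0 else if i < 4 then innerPoint (i - 1) else
    limitPoint ((i - 1) % 3)
      + ((1 / 2) ^ ((i - 4) / 3) : ℝ) • (outerPoint ((i - 1) % 3) - limitPoint ((i - 1) % 3))

/-- The inner corner at which the chain through `i` ends. -/
def innerEnd (i : ℕ) : ℕ := 1 + (i - 1) % 3

/-- The outer corner to which all vertices of the chain through `i` are joined. -/
def outerEnd (i : ℕ) : ℕ := 4 + i % 3

theorem spiralPoint_innerEnd (i : ℕ) : spiralPoint (innerEnd i) = innerPoint ((i - 1) % 3) := by
  have : (i - 1) % 3 < 3 := Nat.mod_lt _ (by norm_num)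
  rw [spiralPoint, innerEnd, if_neg (by omega), if_pos (by omega)]
  congr 1
  omega

theorem spiralPoint_outerEnd {i : ℕ} (hi : 4 ≤ i) :
    spiralPoint (outerEnd i) = outerPoint (((i - 1) % 3 + 1) % 3) := by
  rw [spiralPoint, outerEnd, if_neg (by omega), if_neg (by omega)]
  have h1 : (4 + i % 3 - 4) / 3 = 0 := by omega
  have h2 : (4 + i % 3 - 1) % 3 = ((i - 1) % 3 + 1) % 3 := by omega
  rw [h1, h2, pow_zero, one_smul]
  ring

theorem spiralPoint_add_three {i : ℕ} (hi : 4 ≤ i) : spiralPoint (i + 3)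
    = limitPoint ((i - 1) % 3) + (1 / 2 * (1 / 2) ^ ((i - 4) / 3) : ℝ) •
      (outerPoint ((i - 1) % 3) - limitPoint ((i - 1) % 3)) := by
  rw [spiralPoint, if_neg (by omega), if_neg (by omega)]
  have h1 : (i + 3 - 4) / 3 = (i - 4) / 3 + 1 := by omega
  have h2 : (i + 3 - 1) % 3 = (i - 1) % 3 := by omega
  rw [h1, h2, pow_succ']

theorem spiralPoint_of_le {i : ℕ} (hi : 4 ≤ i) : spiralPoint i
    = limitPoint ((i - 1) % 3) + ((1 / 2) ^ ((i - 4) / 3) : ℝ) •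
      (outerPoint ((i - 1) % 3) - limitPoint ((i - 1) % 3)) := by
  rw [spiralPoint, if_neg (by omega), if_neg (by omega)]

theorem spiralPoint_add_three_mem {i : ℕ} (hi : 4 ≤ i) : spiralPoint (i + 3) ∈
    openTriangle (spiralPoint i) (spiralPoint (innerEnd i)) (spiralPoint (outerEnd i)) := by
  refine ⟨1 / 2, 11 / 24, 1 / 24, by norm_num, by norm_num, by norm_num, by norm_num, ?_⟩
  rw [spiralPoint_add_three hi, spiralPoint_of_le hi, spiralPoint_innerEnd,
    spiralPoint_outerEnd hi, limitPoint]
  module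

theorem exists_cone_of_cross {d p q : ℂ} (h1 : 0 < cross d p) (h2 : cross d q < 0)
    (h3 : cross p q < 0) : ∃ a b : ℝ, 0 < a ∧ 0 < b ∧ d = a • p + b • q := by
  have hne : cross p q ≠ 0 := h3.ne
  refine ⟨cross d q / cross p q, -cross d p / cross p q, div_pos_of_neg_of_neg h2 h3,
    div_pos_of_neg_of_neg (by linarith) h3, ?_⟩
  apply Complex.ext <;> simp only [Complex.add_re, Complex.add_im, Complex.smul_re,
    Complex.smul_im, smul_eq_mul] <;> field_simp <;> simp only [cross] <;> ring

/-- The signs showing that the ray from a chain vertex to the target at the origin passes between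
the outer end of the chain and the next vertex, as well as between the outer and the inner end. -/
theorem spiral_signs {r : ℕ} (hr : r < 3) {s : ℝ} (hs0 : 0 < s) (hs1 : s ≤ 1) {x y u a : ℂ}
    (hx : x = limitPoint r + s • (outerPoint r - limitPoint r))
    (hy : y = limitPoint r + (1 / 2 * s) • (outerPoint r - limitPoint r))
    (hu : u = innerPoint r) (ha : a = outerPoint ((r + 1) % 3)) :
    (0 < cross (0 - x) (y - x) ∧ 0 < cross (0 - x) (u - x)) ∧ cross (0 - x) (a - x) < 0 ∧
      cross (y - x) (a - x) < 0 ∧ cross (u - x) (a - x) < 0 := by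
  have hs2 : s ^ 2 ≤ s := by nlinarith
  subst hx hy hu ha
  obtain rfl | rfl | rfl : r = 0 ∨ r = 1 ∨ r = 2 := by omega
  all_goals
    simp only [limitPoint, innerPoint, outerPoint, cross]
    norm_num
    refine ⟨⟨?_, ?_⟩, ?_, ?_, ?_⟩ <;> nlinarith

/-! ### Its tiling -/

/-- An octahedron, drawn with the triangle `4 5 6` outside and the triangle `1 2 3` inside, with the
target `0` inserted into the latter. -/
def baseTiling : Finset (Finset ℕ) :=
  stellar (flipDiagonal (stellar (stellar (stellar (({4, 5, 6} : Finset ℕ).powerset.erase ∅)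
    {4, 5, 6} 1) {5, 6, 1} 2) {6, 1, 2} 3) 6 1 4 3) {1, 2, 3} 0

/-- The chain of the vertex `m + 4` is extended by the vertex `m + 7`. -/
def spiralTiling : ℕ → Finset (Finset ℕ)
  | 0 => baseTiling
  | m + 1 => stellar (spiralTiling m) {m + 4, innerEnd (m + 4), outerEnd (m + 4)} (m + 7)

theorem tiling_octahedron : Tiling spiralPoint
    (flipDiagonal (stellar (stellar (stellar (({4, 5, 6} : Finset ℕ).powerset.erase ∅)
    {4, 5, 6} 1) {5, 6, 1} 2) {6, 1, 2} 3) 6 1 4 3) {4, 5, 6} := by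
  have p1 : spiralPoint 1 = ⟨2, -1⟩ := by simp [spiralPoint, innerPoint]
  have p2 : spiralPoint 2 = ⟨1, 3⟩ := by simp [spiralPoint, innerPoint]
  have p3 : spiralPoint 3 = ⟨-3, -2⟩ := by simp [spiralPoint, innerPoint]
  have p4 : spiralPoint 4 = ⟨10, 0⟩ := by simp [spiralPoint, outerPoint]
  have p5 : spiralPoint 5 = ⟨0, 10⟩ := by simp [spiralPoint, outerPoint]
  have p6 : spiralPoint 6 = ⟨-10, -10⟩ := by simp [spiralPoint, outerPoint]
  have T1 := Tiling.triangle (P := spiralPoint) (a := 4) (b := 5) (c := 6) (by simp) (by simp)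
    (by simp) (by rw [p4, p5, p6]; norm_num [orient, cross])
  have T2 := T1.insert_vertex (a := 4) (b := 5) (c := 6) (v := 1) (by simp) (by simp) (by simp)
    (by decide) (by decide) ⟨1 / 2, 1 / 5, 3 / 10, by norm_num, by norm_num, by norm_num,
      by norm_num, by rw [p1, p4, p5, p6]; apply Complex.ext <;> norm_num⟩
  have T3 := T2.insert_vertex (a := 5) (b := 6) (c := 1) (v := 2) (by simp) (by simp) (by simp)
    (by decide +kernel) (by decide +kernel) ⟨19 / 50, 1 / 50, 3 / 5, by norm_num, by norm_num,
      by norm_num, by norm_num, by rw [p1, p2, p5, p6]; apply Complex.ext <;> norm_num⟩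
  have T4 := T3.insert_vertex (a := 6) (b := 1) (c := 2) (v := 3) (by simp) (by simp) (by simp)
    (by decide +kernel) (by decide +kernel) ⟨7 / 19, 1 / 19, 11 / 19, by norm_num, by norm_num,
      by norm_num, by norm_num, by rw [p1, p2, p3, p6]; apply Complex.ext <;> norm_num⟩
  have hdown : ∀ σ ∈ flipDiagonal (stellar (stellar (stellar
      (({4, 5, 6} : Finset ℕ).powerset.erase ∅) {4, 5, 6} 1) {5, 6, 1} 2) {6, 1, 2} 3) 6 1 4 3,
      σ.Nonempty ∧ σ.card ≤ 3 ∧ ∀ τ ∈ σ.powerset, τ.Nonempty → τ ∈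
        flipDiagonal (stellar (stellar (stellar (({4, 5, 6} : Finset ℕ).powerset.erase ∅)
          {4, 5, 6} 1) {5, 6, 1} 2) {6, 1, 2} 3) 6 1 4 3 := by decide +kernel
  have hout : ∀ τ ∈ ({4, 5, 6} : Finset ℕ).powerset, τ.card = 2 → τ ∈
        flipDiagonal (stellar (stellar (stellar (({4, 5, 6} : Finset ℕ).powerset.erase ∅)
          {4, 5, 6} 1) {5, 6, 1} 2) {6, 1, 2} 3) 6 1 4 3 := by decide +kernel
  refine ⟨fun σ hσ => (hdown σ hσ).1, fun σ hσ => (hdown σ hσ).2.1,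
    fun σ hσ τ hτ => (hdown σ hσ).2.2 τ (Finset.mem_powerset.2 hτ), by decide,
    fun τ hτ => hout τ (Finset.mem_powerset.2 hτ), ?_⟩
  refine T4.partitions.flipDiagonal (m := ⟨50 / 31, -40 / 31⟩) (by simp) (by simp) (by simp)
    (by simp) (by simp) (by simp) (by decide +kernel) (by decide +kernel) ?_ ?_ ?_ ?_ ?_ ?_
  · rw [p1, p4, p6]; norm_num [orient, cross]
  · rw [p1, p3, p6]; norm_num [orient, cross]
  · rw [p3, p4, p6]; norm_num [orient, cross]
  · rw [p1, p3, p4]; norm_num [orient, cross]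
  · refine ⟨1 / 31, 30 / 31, by norm_num, by norm_num, by norm_num, ?_⟩
    rw [p1, p6]; apply Complex.ext <;> norm_num
  · refine ⟨11 / 31, 20 / 31, by norm_num, by norm_num, by norm_num, ?_⟩
    rw [p3, p4]; apply Complex.ext <;> norm_num

theorem tiling_base : Tiling spiralPoint baseTiling {4, 5, 6} := by
  refine tiling_octahedron.insert_vertex (by simp) (by simp) (by simp) (by decide +kernel)
    (by decide +kernel) ⟨1 / 3, 1 / 3, 1 / 3, by norm_num, by norm_num, by norm_num,
      by norm_num, ?_⟩
  simp only [spiralPoint, innerPoint]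
  apply Complex.ext <;> norm_num

theorem spiralTiling_spec (m : ℕ) : Tiling spiralPoint (spiralTiling m) {4, 5, 6} ∧
    (∀ i, {i} ∈ spiralTiling m ↔ i < m + 7) ∧
    (∀ i, 4 ≤ i → i < m + 4 → {i, i + 3, outerEnd i} ∈ spiralTiling m) ∧
    (∀ i, m + 4 ≤ i → i < m + 7 → {i, innerEnd i, outerEnd i} ∈ spiralTiling m) ∧
    ∀ i, 1 ≤ i → i < 4 → {i, 0} ∈ spiralTiling m := by
  induction m with
  | zero =>
    refine ⟨tiling_base, ?_, by omega, ?_, ?_⟩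
    · intro i
      have h1 : ∀ i ∈ Finset.range 7, {i} ∈ baseTiling := by decide +kernel
      have h2 : ∀ σ ∈ baseTiling, ∀ i ∈ σ, i < 7 := by decide +kernel
      exact ⟨fun h => h2 _ h i (by simp), fun h => h1 i (by simpa using h)⟩
    · have h1 : ∀ i ∈ Finset.Ico 4 7, {i, innerEnd i, outerEnd i} ∈ baseTiling := by
        decide +kernel
      exact fun i hi hi' => h1 i (Finset.mem_Ico.2 ⟨by omega, by omega⟩)
    · have h1 : ∀ i ∈ Finset.Ico 1 4, {i, 0} ∈ baseTiling := by decide +kernel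
      exact fun i hi hi' => h1 i (Finset.mem_Ico.2 ⟨hi, hi'⟩)
  | succ m ih =>
    obtain ⟨T, hn, h1, h2, h3⟩ := ih
    have hU : ∀ i, 1 ≤ innerEnd i ∧ innerEnd i < 4 := fun i => by unfold innerEnd; omega
    have hA : ∀ i, 4 ≤ outerEnd i ∧ outerEnd i < 7 := fun i => by unfold outerEnd; omega
    have hUA : ∀ i j, innerEnd i ≠ outerEnd j := fun i j => by
      have := hU i; have := hA j; omega
    have hUi : ∀ i j, 4 ≤ j → innerEnd i ≠ j := fun i j => by have := hU i; omega
    have hAi : m + 4 ≠ outerEnd (m + 4) := by unfold outerEnd; omega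
    have hc := card_triple (hUi (m + 4) (m + 4) (by omega)).symm hAi (hUA (m + 4) (m + 4))
    have hf := h2 (m + 4) le_rfl (by omega)
    refine ⟨T.insert_vertex (hUi _ _ (by omega)).symm hAi (hUA _ _) hf ?_
      (spiralPoint_add_three_mem (by omega)), ?_, ?_, ?_, ?_⟩
    · exact fun σ hσ h => absurd (T.lt_of_mem hn hσ h) (lt_irrefl _)
    · intro i
      rw [spiralTiling, singleton_mem_stellar hc, hn]
      omega
    · intro i hi hi'
      rcases Nat.lt_or_ge i (m + 4) with h | h
      · refine mem_stellar_of_notMem (h1 i hi h) (i := innerEnd (m + 4)) (by simp) ?_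
        simp [hUA, hUi _ i hi, hUi _ (i + 3) (by omega)]
      · obtain rfl : i = m + 4 := by omega
        rw [Finset.insert_comm]
        refine insert_mem_stellar (i := innerEnd (m + 4)) (by grind) (by simp) ?_
        simp [hUA, hUi _ (m + 4) (by omega)]
    · intro i hi hi'
      rcases Nat.lt_or_ge i (m + 7) with h | h
      · refine mem_stellar_of_notMem (h2 i (by omega) h) (i := innerEnd (m + 4)) (by simp) ?_
        have : innerEnd (m + 4) ≠ innerEnd i := by unfold innerEnd; omega
        simp [hUA, hUi _ i (by omega), this]
      · obtain rfl : i = m + 7 := by omega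
        have e1 : innerEnd (m + 7) = innerEnd (m + 4) := by unfold innerEnd; omega
        have e2 : outerEnd (m + 7) = outerEnd (m + 4) := by unfold outerEnd; omega
        rw [e1, e2]
        refine insert_mem_stellar (i := m + 4) (by grind) (by simp) ?_
        simp [(hUi _ (m + 4) (by omega)).symm, hAi]
    · exact fun i hi hi' => mem_stellar_of_card (h3 i hi hi') hc Finset.card_le_two

/-- The triangulations with exponential expected routing time. -/
theorem exists_triangulation_spiral (n : ℕ) (hn7 : 7 ≤ n) :
    ∃ (G : GeometricGraph (Fin n)) (s t : Fin n), G.IsTriangulation ∧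
      G.expectedSteps s t < ⊤ ∧
      ENNReal.ofReal (1 + 2 ^ ((n - 4) / 3) / 4) ≤ G.expectedSteps s t := by
  obtain ⟨m, rfl⟩ : ∃ m, n = m + 7 := ⟨n - 7, by omega⟩
  obtain ⟨T, hn, h1, h2, h3⟩ := spiralTiling_spec m
  have hP := T.injective hn
  obtain ⟨t, ht⟩ : ∃ t : Fin (m + 7), (t : ℕ) = 0 := ⟨0, rfl⟩
  obtain ⟨s, hs⟩ : ∃ s : Fin (m + 7), (s : ℕ) = 4 := ⟨⟨4, by omega⟩, rfl⟩
  have hinner : ∀ v : Fin (m + 7), v ≠ t → (v : ℕ) < 4 →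
      (tilingGraph spiralPoint (spiralTiling m) (m + 7) hP).ccw t v = t := by
    intro v hv h4
    have hv' : (v : ℕ) ≠ t := fun h => hv (Fin.ext h)
    exact T.ccw_eq_target hn hP ⟨hv, by rw [ht]; exact h3 v (by omega) h4⟩
  have p0 : spiralPoint t = 0 := by rw [ht]; simp [spiralPoint]
  have houter : ∀ v : Fin (m + 7), 4 ≤ (v : ℕ) →
      (((tilingGraph spiralPoint (spiralTiling m) (m + 7) hP).ccw t v : ℕ)
        = if (v : ℕ) < m + 4 then (v : ℕ) + 3 else innerEnd v) ∧
      ((tilingGraph spiralPoint (spiralTiling m) (m + 7) hP).cw t v : ℕ) = outerEnd v := by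
    intro v hv
    have hA : outerEnd v < m + 7 := by unfold outerEnd; omega
    have hvA : (v : ℕ) ≠ outerEnd v := by unfold outerEnd; omega
    obtain ⟨⟨e1, e2⟩, e3, e4, e5⟩ := spiral_signs (r := ((v : ℕ) - 1) % 3)
      (Nat.mod_lt _ (by norm_num)) (s := (1 / 2) ^ (((v : ℕ) - 4) / 3)) (by positivity)
      (pow_le_one₀ (by norm_num) (by norm_num)) (spiralPoint_of_le hv) (spiralPoint_add_three hv)
      (spiralPoint_innerEnd v) (spiralPoint_outerEnd hv)
    rw [← p0] at e1 e2 e3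
    split_ifs with h
    · have := T.compass_eq hn hP (t := t) (v := v) (u := ⟨v + 3, by omega⟩)
        (w := ⟨outerEnd v, hA⟩) (by rw [Ne, Fin.ext_iff]; simp)
        (by rw [Ne, Fin.ext_iff]; exact hvA)
        (by rw [Ne, Fin.ext_iff]; dsimp only; unfold outerEnd; omega) (h1 v hv h)
        ⟨e1, exists_cone_of_cross e1 e3 e4⟩
      rw [this.1, this.2]
      exact ⟨rfl, rfl⟩
    · have hU : innerEnd v < 4 := by unfold innerEnd; omega
      have hA' : 4 ≤ outerEnd v := by unfold outerEnd; omega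
      have := T.compass_eq hn hP (t := t) (v := v) (u := ⟨innerEnd v, by omega⟩)
        (w := ⟨outerEnd v, hA⟩) (by rw [Ne, Fin.ext_iff]; dsimp only; omega)
        (by rw [Ne, Fin.ext_iff]; exact hvA)
        (by rw [Ne, Fin.ext_iff]; dsimp only; omega) (h2 v (by omega) v.2)
        ⟨e2, exists_cone_of_cross e2 e3 e5⟩
      rw [this.1, this.2]
      exact ⟨rfl, rfl⟩
  refine ⟨tilingGraph spiralPoint (spiralTiling m) (m + 7) hP, s, t, T.isTriangulation hn hP,
    ?_, ?_⟩
  · refine GeometricGraph.expectedSteps_lt_top _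
      (ρ := fun v : Fin (m + 7) => if (v : ℕ) = 0 then 0 else if (v : ℕ) < 4 then 1 else m + 9 - v)
      (N := m + 9) ?_ ?_ (by omega)
    · intro v hv
      have hv' : (v : ℕ) ≠ t := fun h => hv (Fin.ext h)
      rcases Nat.lt_or_ge v 4 with h | h
      · rw [hinner v hv h, ht]
        simp [h, show (v : ℕ) ≠ 0 by omega]
      · have hU : 1 ≤ innerEnd v ∧ innerEnd v < 4 := by unfold innerEnd; omega
        rw [(houter v h).1]
        have := v.2
        split_ifs <;> omega
    · intro v
      split_ifs <;> omega
  · refine GeometricGraph.le_expectedSteps _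
      (l := fun v : Fin (m + 7) => if (v : ℕ) < 4 then 0 else (m + 6 - v) / 3 + 1)
      (K := (m + 7 - 4) / 3) ?_ ?_ ?_ ?_ (by omega)
    · rw [hs, if_neg (by omega)]
      omega
    · rw [ht]
      rfl
    · intro v hv
      have h4 : 4 ≤ (v : ℕ) := by
        by_contra! h
        rw [if_pos h] at hv
        exact lt_irrefl _ hv
      have hA : 4 ≤ outerEnd v ∧ outerEnd v < 7 := by unfold outerEnd; omega
      rw [(houter v h4).2, if_neg (by omega)]
      omega
    · intro v hv
      have h4 : 4 ≤ (v : ℕ) := by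
        by_contra! h
        rw [if_pos h] at hv
        exact lt_irrefl _ hv
      rw [(houter v h4).1]
      have hU : innerEnd v < 4 := by unfold innerEnd; omega
      have := v.2
      split_ifs <;> omega

/-! ### Numerical bounds -/

theorem two_rpow_le_of_le {n k : ℕ} (h : (n : ℝ) ≤ 3 * k + 6) (hk : 1 ≤ k) :
    (2 : ℝ) ^ (1 / 144 * (n : ℝ)) ≤ 1 + 2 ^ k / 4 := by
  rcases Nat.lt_or_ge 17 n with hn | hn
  · have hn' : (18 : ℝ) ≤ n := by exact_mod_cast hn
    calc (2 : ℝ) ^ (1 / 144 * (n : ℝ)) ≤ 2 ^ ((k : ℝ) - 2) :=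
          Real.rpow_le_rpow_of_exponent_le (by norm_num) (by linarith)
      _ = 2 ^ k / 4 := by
        rw [Real.rpow_sub (by norm_num), Real.rpow_natCast]
        norm_num
      _ ≤ _ := by linarith
  · have hn' : (n : ℝ) ≤ 17 := by exact_mod_cast hn
    have h2 : (2 : ℝ) ≤ 2 ^ k := le_self_pow₀ (by norm_num) (by omega)
    calc (2 : ℝ) ^ (1 / 144 * (n : ℝ)) ≤ 2 ^ (1 / 2 : ℝ) :=
          Real.rpow_le_rpow_of_exponent_le (by norm_num) (by linarith)
      _ ≤ 3 / 2 := by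
        rw [← Real.sqrt_eq_rpow, Real.sqrt_le_left (by norm_num)]
        norm_num
      _ ≤ _ := by linarith

theorem const_mul_two_rpow_le {n k : ℕ} (h : (n : ℝ) ≤ 3 * k + 6) :
    1 / 144 * (2 : ℝ) ^ ((n : ℝ) / 4) ≤ 1 + 2 ^ k / 4 := by
  have h1 : (2 : ℝ) ^ ((n : ℝ) / 4) ≤ 2 ^ ((k : ℝ) + 2) :=
    Real.rpow_le_rpow_of_exponent_le (by norm_num) (by
      have : (0 : ℝ) ≤ k := k.cast_nonneg
      linarith)
  rw [Real.rpow_add (by norm_num), Real.rpow_natCast] at h1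
  norm_num at h1
  have : (0 : ℝ) < 2 ^ k := by positivity
  linarith

theorem theorem2p1 :
    ∃ c : ℝ, 0 < c ∧ ∀ n : ℕ, 3 ≤ n →
      ∃ (G : GeometricGraph (Fin n)) (s t : Fin n),
        G.IsTriangulation ∧
        G.expectedSteps s t < ⊤ ∧
        ENNReal.ofReal ((2 : ℝ) ^ (c * (n : ℝ))) ≤ G.expectedSteps s t ∧
        ENNReal.ofReal (c * (2 : ℝ) ^ ((n : ℝ) / 4)) ≤ G.expectedSteps s t := by
  refine ⟨1 / 144, by norm_num, fun n hn => ?_⟩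
  obtain ⟨k, hk, hnk, G, s, t, hG, hfin, hle⟩ : ∃ k : ℕ, 1 ≤ k ∧ (n : ℝ) ≤ 3 * k + 6 ∧
      ∃ (G : GeometricGraph (Fin n)) (s t : Fin n), G.IsTriangulation ∧
        G.expectedSteps s t < ⊤ ∧ ENNReal.ofReal (1 + 2 ^ k / 4) ≤ G.expectedSteps s t := by
    rcases Nat.lt_or_ge n 7 with h | h
    · refine ⟨1, le_rfl, ?_, exists_triangulation_fan n hn⟩
      exact_mod_cast (by omega : n ≤ 3 * 1 + 6)
    · refine ⟨(n - 4) / 3, by omega, ?_, exists_triangulation_spiral n h⟩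
      exact_mod_cast (by omega : n ≤ 3 * ((n - 4) / 3) + 6)
  exact ⟨G, s, t, hG, hfin,
    (ENNReal.ofReal_le_ofReal (two_rpow_le_of_le hnk hk)).trans hle,
    (ENNReal.ofReal_le_ofReal (const_mul_two_rpow_le hnk)).trans hle⟩
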